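/- Fix integers $\rho_1,\rho_2,\ldots\ge 1$. A partition of $\mathbb N=\{1,2,\ldots\}$ is a sequence $(b_1,b_2,\ldots)$ of disjoint subsets of $\mathbb N$ with union $\mathbb N$ such that $b_k=\varnothing$ implies $b_{k+1}=\varnothing$, and $\min b_k<\min b_{k+1}$ whenever $b_{k+1}\ne\varnothing$. It is constrained if every nonempty $b_k$ contains the $\rho_k$ least elements of $\bigcup_{j\ge k}b_j$ (all of its elements, if there are fewer than $\rho_k$). A random partition $\Pi=(B_k)$ of $\mathbb N$ is constrained exchangeable if it is almost surely constrained and its law is invariant under the bijections $\sigma:\mathbb N\to\mathbb N$ as far as they preserve this property: if $\sigma$ (acting blockwise, $(b_k)\mapsto(\sigma(b_k))$) maps an event $A$ consisting of constrained partitions onto an event $B$ consisting of constrained partitions, then $\mathbb P(\Pi\in A)=\mathbb P(\Pi\in B)$. Let $\Pi_n$ be the restriction of $\Pi$ to $[n]=\{1,\ldots,n\}$, and let $\mathrm{shape}(\Pi_n)$ be the finite sequence of the positive values among $\#(B_1\cap[n]),\#(B_2\cap[n]),\ldots$ Let $\Pi$ be constrained exchangeable. Then the normalised shapes $\mathrm{shape}(\Pi_n)/n$,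 padded by infinitely many zeroes, converge almost surely in the product topology to a random sequence $(P_1,P_2,\ldots)$ with $P_j\ge 0$ and $\sum_j P_j\le 1$. Conditionally given $(P_k)$, the partition $\Pi$ is generated by successive extension of $\Pi_n$ to $\Pi_{n+1}$, $n=1,2,\ldots$, by the following rules: given $(P_k)$ and $\Pi_n$ with $\mathrm{shape}(\Pi_n)=(\lambda_1,\ldots,\lambda_\ell)$, the element $n+1$ (i) joins the block $B_j$, $j<\ell$, with probability $P_j$; (ii) if $\lambda_\ell<\rho_\ell$, joins the block $B_\ell$ with probability $1-\sum_{j=1}^{\ell-1}P_j$; (iii) if $\lambda_\ell\ge\rho_\ell$, joins the block $B_\ell$ with probability $P_\ell$ or starts the new block $B_{\ell+1}$ with probability $1-\sum_{j=1}^{\ell}P_j$. Hence, for every $n\ge1$ and every composition $\lambda=(\lambda_1,\ldots,\lambda_\ell)$ of $n$ with $\lambda_j\ge\rho_j$ for $j<\ell$, the probability $p(\lambda)=\mathbb P(\mathrm{shape}(\Pi_n)=\lambda)$ is $$p(\lambda)=d(\lambda)\,\mathbb E\left\{\left[\prod_{j=1}^{\ell-1}\Bigl(1-\sum_{i=1}^{j-1}P_i\Bigr)^{\rho_j}P_j^{\lambda_j-\rho_j}\right]\Bigl(1-\sum_{i=1}^{\ell-1}P_i\Bigr)^{\rho_\ell\wedge\lambda_\ell}P_\ell^{(\lambda_\ell-\rho_\ell)_+}\right\},$$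 where $d(\lambda)=\prod_{j=1}^{\ell-1}\binom{\Lambda_j-\rho_j}{\lambda_j-\rho_j}$, $\Lambda_j=\lambda_j+\cdots+\lambda_\ell$, and $0^0=1$. -/

import Mathlib

/-- A partition of `ℕ` into a sequence of blocks, listed in the order of increase of their least
elements. Elements and block labels are counted from `0`: the natural number `i` plays the role of
the element `i + 1`, and `block k` is the `(k + 1)`-st block. -/
structure NatPartition where
  block : ℕ → Set ℕ
  disjoint : Pairwise fun j k => Disjoint (block j) (block k)
  cover : ⋃ k, block k = Set.univ
  empty_succ : ∀ k, block k = ∅ → block (k + 1) = ∅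
  least_lt : ∀ k, (block (k + 1)).Nonempty → sInf (block k) < sInf (block (k + 1))

namespace NatPartition

/-- The `σ`-algebra generated by the events `{i ∈ block k}`, or equivalently by the restrictions
of partitions to finite initial segments. -/
instance instMeasurableSpace : MeasurableSpace NatPartition :=
  MeasurableSpace.comap block inferInstance

/-- The restriction of a partition to its first `n` elements. -/
def restrict (π : NatPartition) (n : ℕ) : ℕ → Set ℕ := fun k => π.block k ∩ Set.Iio n

/-- The shape of the restriction to the first `n` elements: the finite sequence of the positive
block sizes (only the first `n` blocks can meet the first `n` elements). -/
noncomputable def shape (π : NatPartition) (n : ℕ) : List ℕ :=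
  ((List.range n).map fun k => (π.restrict n k).ncard).filter (0 < ·)

/-- `⋃ j ≥ k, block j`. -/
def tail (π : NatPartition) (k : ℕ) : Set ℕ := ⋃ j ≥ k, π.block j

/-- Each nonempty block `k` contains the `ρ k` least elements of `⋃ j ≥ k, block j`, i.e. all the
elements of this union with fewer than `ρ k` predecessors in it. -/
def IsConstrained (ρ : ℕ → ℕ) (π : NatPartition) : Prop :=
  ∀ k, (π.block k).Nonempty →
    ∀ i ∈ π.tail k, {m ∈ π.tail k | m < i}.ncard < ρ k → i ∈ π.block k

/-- `π'` is the image of `π` under the bijection `σ`, block by block. -/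
def IsImage (σ : Equiv.Perm ℕ) (π π' : NatPartition) : Prop :=
  ∀ k, π'.block k = σ '' π.block k

end NatPartition

/-- A random partition that is almost surely constrained and whose law is invariant under the
bijections of `ℕ` as far as these preserve constrained partitions: whenever a bijection `σ` maps
an event `A` consisting of constrained partitions onto an event `B` consisting of constrained
partitions, both have the same probability. -/
def IsConstrainedExchangeable {Ω : Type*} [MeasurableSpace Ω] (μ : MeasureTheory.Measure Ω)
    (ρ : ℕ → ℕ) (X : Ω → NatPartition) : Prop :=
  (∀ᵐ ω ∂μ, (X ω).IsConstrained ρ) ∧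
  ∀ (σ : Equiv.Perm ℕ) (A B : Set NatPartition), MeasurableSet A → MeasurableSet B →
    (∀ π ∈ A, π.IsConstrained ρ) → (∀ π' ∈ B, π'.IsConstrained ρ) →
    (∀ π ∈ A, ∃ π' ∈ B, NatPartition.IsImage σ π π') →
    (∀ π' ∈ B, ∃ π ∈ A, NatPartition.IsImage σ π π') →
    μ (X ⁻¹' A) = μ (X ⁻¹' B)

/-- The probability with which the next element is put into block `j`, for frequencies `p`, when
the shape so far is the nonempty list `l`. The last block so far has label `l.length - 1`, and
`j = l.length` stands for a new block. -/
noncomputable def stepProb (ρ : ℕ → ℕ) (p : ℕ → ℝ) (l : List ℕ) (j : ℕ) : ℝ :=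
  if j + 1 < l.length then p j
  else if l.getD (l.length - 1) 0 < ρ (l.length - 1) then
    if j + 1 = l.length then 1 - ∑ i ∈ Finset.range j, p i else 0
  else
    if j + 1 = l.length then p j
    else if j = l.length then 1 - ∑ i ∈ Finset.range j, p i else 0

/-- Conditionally given `P`, the random partition `X` is obtained by successive extension of its
restriction to the first `n` elements, `n = 1, 2, …`: given `P` and this restriction, the next
element (the number `n`) joins block `j` with the conditional probability `stepProb`. -/
def IsDirectedBy {Ω : Type*} [MeasurableSpace Ω] (μ : MeasureTheory.Measure Ω)
    (ρ : ℕ → ℕ) (P : Ω → ℕ → ℝ) (X : Ω → NatPartition) : Prop :=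
  ∀ n : ℕ, 1 ≤ n → ∀ j : ℕ,
    MeasureTheory.condExp
        (MeasurableSpace.comap (fun ω => (P ω, (X ω).restrict n)) inferInstance) μ
        (Set.indicator {ω | n ∈ (X ω).block j} fun _ => (1 : ℝ))
      =ᵐ[μ] fun ω => stepProb ρ (P ω) ((X ω).shape n) j

/-- A composition is constrained if all its parts but the last one satisfy `l j ≥ ρ j`. -/
def IsConstrainedComposition (ρ : ℕ → ℕ) (l : List ℕ) : Prop :=
  ∀ j, j + 1 < l.length → ρ j ≤ l.getD j 0

/-- `∏ (Λ j - ρ j choose l j - ρ j)` over all parts but the last one, where `Λ j` is the sum of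
the parts from the `j`-th on. -/
def numConstrained (ρ : ℕ → ℕ) (l : List ℕ) : ℕ :=
  ∏ j ∈ Finset.range (l.length - 1), ((l.drop j).sum - ρ j).choose (l.getD j 0 - ρ j)

/-- The integrand of the mixture formula for the distribution of shapes. -/
noncomputable def mixtureTerm (ρ : ℕ → ℕ) (p : ℕ → ℝ) (l : List ℕ) : ℝ :=
  (∏ j ∈ Finset.range (l.length - 1),
      (1 - ∑ i ∈ Finset.range j, p i) ^ ρ j * p j ^ (l.getD j 0 - ρ j)) *
    (1 - ∑ i ∈ Finset.range (l.length - 1), p i) ^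
      min (ρ (l.length - 1)) (l.getD (l.length - 1) 0) *
    p (l.length - 1) ^ (l.getD (l.length - 1) 0 - ρ (l.length - 1))

/-!
The proof rests on one symmetry. Suppose that block `j` already has its quota of `ρ j` elements
among the first `n` elements. If a constrained partition has the element `n` in block `j`, then
moving this single element to a later place `m`, and shifting the elements in between down by one,
gives again a constrained partition: the subsequence of the elements outside block `j` is not
touched, and the quotas of the blocks up to `j` are filled before `n`
(`NatPartition.IsConstrained.exists_isImage`). Since the move can be undone, constrained
exchangeability says that `n` and `m` belong to block `j` with equal probabilities, within any event
that is determined by the restriction to the first `n` elements and by quantities insensitive to the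
move (`IsConstrainedExchangeable.measure_mem_block_eq`).

Two consequences follow. First, on the event that block `j` has its quota at time `n`, the events
that block `j` contains the elements `n`, `n + 1`, … have constant probabilities and constant pair
correlations. A second moment estimate along fourth powers, together with monotone interpolation,
shows that averages of such variables converge (`ae_exists_tendsto_average`), so the frequencies
exist almost surely; a block that never gets its quota is finite and has frequency `0`. Secondly,
the frequencies do not change under a move, so the event may involve them. Averaging over `m` up to
infinity then identifies the frequency of block `j` as the conditional probability, given the
frequencies and the restriction to the first `n` elements, that the next element joins block `j`.
The next element joins a block with its quota or the first block without it, so the latter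
gets the remaining mass (`IsConstrainedExchangeable.condExp_mem_block`).

The distribution of the shapes follows from these transition probabilities by induction on `n`: the
conditional probability of an arrangement depends on the block sizes only, and the numbers of
constrained arrangements satisfy an iterated Pascal rule when they are split according to the block
of the last element (`sum_numArrangements_removeOne`,
`IsConstrainedExchangeable.condExp_counts_eq`).
-/

namespace NatPartition

/-! ### Deterministic facts about partitions -/

/-- The number of elements of block `k` among the first `n` elements. -/
noncomputable def counts (π : NatPartition) (n k : ℕ) : ℕ := (π.restrict n k).ncard

variable {π π' : NatPartition} {ρ : ℕ → ℕ} {n m i j k : ℕ}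

theorem exists_mem_block (π : NatPartition) (i : ℕ) : ∃ k, i ∈ π.block k := by
  have : i ∈ ⋃ k, π.block k := by rw [π.cover]; trivial
  simpa using this

theorem eq_of_mem_block (hj : i ∈ π.block j) (hk : i ∈ π.block k) : j = k := by
  by_contra h
  exact Set.disjoint_left.1 (π.disjoint h) hj hk

theorem block_nonempty_of_le (h : j ≤ k) (hk : (π.block k).Nonempty) : (π.block j).Nonempty := by
  induction h with
  | refl => exact hk
  | @step k _ ih =>
    refine ih ?_
    rw [Set.nonempty_iff_ne_empty] at hk ⊢
    exact fun h => hk (π.empty_succ _ h)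

theorem sInf_block_lt (h : j < k) (hk : (π.block k).Nonempty) :
    sInf (π.block j) < sInf (π.block k) := by
  induction h with
  | refl => exact π.least_lt _ hk
  | @step k _ ih => exact (ih (block_nonempty_of_le k.le_succ hk)).trans (π.least_lt _ hk)

theorem restrict_finite (π : NatPartition) (n k : ℕ) : (π.restrict n k).Finite :=
  (Set.finite_Iio n).subset Set.inter_subset_right

theorem counts_pos_iff : 0 < π.counts n k ↔ ∃ i ∈ π.block k, i < n := by
  rw [counts, Set.ncard_pos (π.restrict_finite n k)]
  rfl

theorem counts_eq_sum (π : NatPartition) (n k : ℕ) :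
    (π.counts n k : ℝ) = ∑ i ∈ Finset.range n, (π.block k).indicator 1 i := by
  classical
  have : π.restrict n k = ((Finset.range n).filter (· ∈ π.block k) : Finset ℕ) := by
    ext i; simp [restrict, and_comm]
  rw [counts, this, Set.ncard_coe_finset]
  simp [Set.indicator_apply]

theorem counts_succ_of_mem (h : n ∈ π.block k) : π.counts (n + 1) k = π.counts n k + 1 := by
  have := π.counts_eq_sum (n + 1) k
  rw [Finset.sum_range_succ, ← counts_eq_sum, Set.indicator_of_mem h, Pi.one_apply] at this
  exact_mod_cast this

theorem counts_succ_of_notMem (h : n ∉ π.block k) : π.counts (n + 1) k = π.counts n k := by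
  have := π.counts_eq_sum (n + 1) k
  rw [Finset.sum_range_succ, ← counts_eq_sum, Set.indicator_of_notMem h, add_zero] at this
  exact_mod_cast this

theorem counts_zero (π : NatPartition) (k : ℕ) : π.counts 0 k = 0 := by
  have := π.counts_eq_sum 0 k
  simpa using this

theorem counts_mono (π : NatPartition) (k : ℕ) : Monotone fun n => π.counts n k :=
  fun _ b h => Set.ncard_le_ncard
    (Set.inter_subset_inter_right _ (Set.Iio_subset_Iio h)) (π.restrict_finite b k)

theorem counts_pos_of_le (h : j ≤ k) (hk : 0 < π.counts n k) : 0 < π.counts n j := by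
  rcases h.eq_or_lt with rfl | h
  · exact hk
  rw [counts_pos_iff] at hk ⊢
  obtain ⟨i, hi, hin⟩ := hk
  have hne : (π.block k).Nonempty := ⟨i, hi⟩
  exact ⟨_, Nat.sInf_mem (block_nonempty_of_le h.le hne),
    (sInf_block_lt h hne).trans_le ((Nat.sInf_le hi).trans hin.le)⟩

theorem le_sInf_block (hk : (π.block k).Nonempty) : k ≤ sInf (π.block k) := by
  induction k with
  | zero => exact Nat.zero_le _
  | succ k ih => exact (ih (block_nonempty_of_le k.le_succ hk)).trans_lt (π.least_lt k hk)

theorem counts_eq_zero_of_le (h : n ≤ k) : π.counts n k = 0 := by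
  by_contra hne
  obtain ⟨i, hi, hin⟩ := counts_pos_iff.1 (Nat.pos_of_ne_zero hne)
  have := (le_sInf_block ⟨i, hi⟩).trans (Nat.sInf_le hi)
  omega

theorem counts_zero_pos (hn : 1 ≤ n) : 0 < π.counts n 0 := by
  obtain ⟨k, hk⟩ := π.exists_mem_block 0
  exact counts_pos_of_le k.zero_le (counts_pos_iff.2 ⟨0, hk, hn⟩)

theorem sum_counts (π : NatPartition) {J : ℕ} (h : n ≤ J) :
    ∑ k ∈ Finset.range J, π.counts n k = n := by
  induction n with
  | zero => simp [counts_zero]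
  | succ n ih =>
    obtain ⟨k, hk⟩ := π.exists_mem_block n
    have hkn : k < J := by
      have := (le_sInf_block ⟨n, hk⟩).trans (Nat.sInf_le hk)
      omega
    have : ∀ i, π.counts (n + 1) i = π.counts n i + if i = k then 1 else 0 := fun i => by
      split_ifs with h
      · subst h; exact counts_succ_of_mem hk
      · rw [add_zero]
        exact counts_succ_of_notMem fun hi => h (eq_of_mem_block hi hk)
    simp [this, Finset.sum_add_distrib, ih (by omega), hkn]

/-- The blocks meeting an initial segment are the first ones, so the shape lists their sizes. -/
theorem shape_eq_map_range (π : NatPartition) (n : ℕ) :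
    ∃ L, (∀ k, 0 < π.counts n k ↔ k < L) ∧ π.shape n = (List.range L).map (π.counts n) := by
  classical
  have hex : ∃ L, π.counts n L = 0 := ⟨n, counts_eq_zero_of_le le_rfl⟩
  set L := Nat.find hex with hL
  have hiff : ∀ k, 0 < π.counts n k ↔ k < L := fun k => by
    refine ⟨fun h => ?_, fun h => Nat.pos_of_ne_zero (Nat.find_min hex h)⟩
    by_contra hk
    have := counts_pos_of_le (not_lt.1 hk) h
    rw [Nat.find_spec hex] at this
    exact this.false
  refine ⟨L, hiff, ?_⟩
  have hLn : L ≤ n := Nat.find_min' hex (counts_eq_zero_of_le le_rfl)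
  obtain ⟨r, hr⟩ := Nat.exists_eq_add_of_le hLn
  change ((List.range n).map (π.counts n)).filter (0 < ·) = _
  conv_lhs => rw [show List.range n = List.range (L + r) by rw [← hr]]
  rw [List.range_add, List.map_append, List.filter_append, List.filter_eq_self.2,
    List.filter_eq_nil_iff.2, List.append_nil]
  · intro a ha
    simp only [List.mem_map, List.mem_range] at ha
    obtain ⟨_, ⟨i, _, rfl⟩, rfl⟩ := ha
    simpa using mt (hiff (L + i)).1 (by omega)
  · intro a ha
    simp only [List.mem_map, List.mem_range] at ha
    obtain ⟨i, hi, rfl⟩ := ha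
    simpa using (hiff i).2 hi

theorem shape_getD (π : NatPartition) (n k : ℕ) : (π.shape n).getD k 0 = π.counts n k := by
  obtain ⟨L, hL, h⟩ := π.shape_eq_map_range n
  rw [h]
  rcases lt_or_ge k L with hk | hk
  · simp [List.getD_eq_getElem?_getD, hk]
  · have := mt (hL k).1 (not_lt.2 hk)
    simp [List.getD_eq_getElem?_getD, hk]
    omega

theorem lt_length_shape_iff : k < (π.shape n).length ↔ 0 < π.counts n k := by
  obtain ⟨L, hL, h⟩ := π.shape_eq_map_range n
  rw [h, hL]
  simp

theorem shape_eq_iff {l : List ℕ} (hl : ∀ a ∈ l, 0 < a) :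
    π.shape n = l ↔ π.counts n = fun k => l.getD k 0 := by
  refine ⟨fun h => by ext k; rw [← h, shape_getD], fun h => ?_⟩
  have hlen : ∀ k, k < (π.shape n).length ↔ k < l.length := fun k => by
    rw [lt_length_shape_iff, h]
    change 0 < l.getD k 0 ↔ _
    refine ⟨fun hk => ?_, fun hk => ?_⟩
    · by_contra hk'
      rw [List.getD_eq_default _ _ (not_lt.1 hk')] at hk
      exact hk.false
    · rw [List.getD_eq_getElem _ _ hk]
      exact hl _ (List.getElem_mem hk)
  have hlen' : (π.shape n).length = l.length :=
    le_antisymm (not_lt.1 fun h => (lt_irrefl _) ((hlen _).1 h))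
      (not_lt.1 fun h => (lt_irrefl _) ((hlen _).2 h))
  refine List.ext_getElem hlen' fun k h₁ h₂ => ?_
  rw [← List.getD_eq_getElem _ 0 h₁, shape_getD, h, ← List.getD_eq_getElem _ 0 h₂]

theorem mem_tail_iff : i ∈ π.tail k ↔ ∃ j, k ≤ j ∧ i ∈ π.block j := by
  simp [tail]

/-- In a constrained partition a block that is followed by another one has its full quota. -/
theorem IsConstrained.le_counts (h : π.IsConstrained ρ) (hjk : j < k) (hk : 0 < π.counts n k) :
    ρ j ≤ π.counts n j := by
  obtain ⟨i, hi, hin⟩ := counts_pos_iff.1 hk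
  have hne : (π.block k).Nonempty := ⟨i, hi⟩
  have hit : i ∈ π.tail (j + 1) := mem_tail_iff.2 ⟨k, hjk, hi⟩
  -- the least element of the later blocks is preceded by elements of block `j` only
  set s := sInf (π.tail (j + 1)) with hs
  have hst : s ∈ π.tail (j + 1) := Nat.sInf_mem ⟨i, hit⟩
  have hsn : s < n := (Nat.sInf_le hit).trans_lt hin
  obtain ⟨q, hq, hsq⟩ := mem_tail_iff.1 hst
  have hsj : s ∉ π.block j := fun hsj => by
    have := eq_of_mem_block hsj hsq
    omega
  have h1 : ρ j ≤ {m ∈ π.tail j | m < s}.ncard := by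
    by_contra hlt
    exact hsj (h j (block_nonempty_of_le hjk.le hne) s (mem_tail_iff.2 ⟨q, by omega, hsq⟩)
      (not_le.1 hlt))
  refine h1.trans (Set.ncard_le_ncard ?_ (π.restrict_finite n j))
  rintro m ⟨hm, hms⟩
  obtain ⟨r, hr, hmr⟩ := mem_tail_iff.1 hm
  rcases hr.eq_or_lt with rfl | hr
  · exact ⟨hmr, hms.trans hsn⟩
  · exact absurd (Nat.sInf_le (mem_tail_iff.2 ⟨r, hr, hmr⟩)) (not_le.2 hms)

theorem IsImage.mem_block_iff {σ : Equiv.Perm ℕ} (h : IsImage σ π π') :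
    σ i ∈ π'.block k ↔ i ∈ π.block k := by
  rw [h k, σ.injective.mem_set_image]

theorem IsImage.mem_tail_iff {σ : Equiv.Perm ℕ} (h : IsImage σ π π') :
    σ i ∈ π'.tail k ↔ i ∈ π.tail k := by
  simp [NatPartition.mem_tail_iff, h.mem_block_iff]

/-- Moving a single element `p` of a block that has its quota among the first `n` elements to
another place beyond these, while the order of all other elements is kept, leads from constrained
partitions to constrained partitions. -/
theorem IsConstrained.exists_isImage (hρ : ∀ k, 1 ≤ ρ k) (h : π.IsConstrained ρ)
    (hj : ρ j ≤ π.counts n j) {p : ℕ} (hp : p ∈ π.block j) (hnp : n ≤ p) {σ : Equiv.Perm ℕ}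
    (hfix : ∀ i < n, σ i = i) (hσ : StrictMonoOn σ {p}ᶜ) :
    ∃ π', π'.IsConstrained ρ ∧ IsImage σ π π' := by
  have hfix' : ∀ i, σ i < n → σ i = i := fun i hi => σ.injective (hfix _ hi)
  have hσp : n ≤ σ p := not_lt.1 fun hlt => by have := hfix' p hlt; omega
  have hjn : ∃ s ∈ π.block j, s < n := counts_pos_iff.1 ((hρ j).trans hj)
  obtain ⟨s, hsj, hsn⟩ := hjn
  have hminj : sInf (π.block j) < n := (Nat.sInf_le hsj).trans_lt hsn
  -- the least elements of the blocks are different from `p`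
  have hminp : ∀ k, (π.block k).Nonempty → sInf (π.block k) ≠ p := fun k hk heq => by
    have hkj : k = j := eq_of_mem_block (heq ▸ Nat.sInf_mem hk) hp
    subst hkj
    omega
  have hmin : ∀ k, (π.block k).Nonempty → sInf (σ '' π.block k) = σ (sInf (π.block k)) := by
    intro k hk
    refine le_antisymm (Nat.sInf_le ⟨_, Nat.sInf_mem hk, rfl⟩) (le_csInf (hk.image σ) ?_)
    rintro _ ⟨i, hi, rfl⟩
    by_cases hip : i = p
    · subst hip
      have hkj : k = j := eq_of_mem_block hi hp
      subst hkj
      rw [hfix _ hminj]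
      omega
    · exact (hσ.le_iff_le (hminp k hk) hip).2 (Nat.sInf_le hi)
  let π' : NatPartition :=
    { block := fun k => σ '' π.block k
      disjoint := fun a b hab => (Set.disjoint_image_iff σ.injective).2 (π.disjoint hab)
      cover := by rw [← Set.image_iUnion, π.cover, Set.image_univ, σ.surjective.range_eq]
      empty_succ := fun k hk => by
        rw [Set.image_eq_empty] at hk ⊢
        exact π.empty_succ k hk
      least_lt := fun k hk => by
        have hk1 : (π.block (k + 1)).Nonempty := Set.image_nonempty.1 hk
        have hk0 := block_nonempty_of_le k.le_succ hk1
        rw [hmin _ hk0, hmin _ hk1]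
        exact hσ (hminp k hk0) (hminp _ hk1) (π.least_lt k hk1) }
  have himg : IsImage σ π π' := fun k => rfl
  refine ⟨π', fun k hk i' hi' hcard => ?_, himg⟩
  replace hk : (π.block k).Nonempty := Set.image_nonempty.1 hk
  obtain ⟨i, rfl⟩ := σ.surjective i'
  rw [himg.mem_tail_iff] at hi'
  rw [himg.mem_block_iff]
  rcases lt_or_ge j k with hjk | hkj
  · -- the blocks from `k` on do not contain `p`
    have hpt : ∀ i ∈ π.tail k, i ≠ p := by
      rintro i hi rfl
      obtain ⟨q, hq, hiq⟩ := NatPartition.mem_tail_iff.1 hi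
      have := eq_of_mem_block hiq hp
      omega
    refine h k hk i hi' (lt_of_eq_of_lt ?_ hcard)
    rw [← Set.ncard_image_of_injective _ σ.injective]
    congr 1
    ext m'
    obtain ⟨m, rfl⟩ := σ.surjective m'
    rw [σ.injective.mem_set_image]
    simp only [Set.mem_ofPred_eq, himg.mem_tail_iff]
    exact and_congr_right fun hm => (hσ.lt_iff_lt (hpt m hm) (hpt i hi')).symm
  · -- the quota of block `k` is filled by elements that stay fixed
    have hfull : ρ k ≤ {m ∈ π.tail k | m < n}.ncard := by
      have hfin : {m ∈ π.tail k | m < n}.Finite := (Set.finite_Iio n).subset fun m hm => hm.2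
      rcases hkj.eq_or_lt with rfl | hkj
      · refine hj.trans (Set.ncard_le_ncard ?_ hfin)
        exact fun m hm => ⟨NatPartition.mem_tail_iff.2 ⟨k, le_rfl, hm.1⟩, hm.2⟩
      · refine (h.le_counts hkj ((hρ j).trans hj)).trans (Set.ncard_le_ncard ?_ hfin)
        exact fun m hm => ⟨NatPartition.mem_tail_iff.2 ⟨k, le_rfl, hm.1⟩, hm.2⟩
    have hsub : ∀ m, m < n → (m ∈ π'.tail k ↔ m ∈ π.tail k) := fun m hm => by
      conv_lhs => rw [← hfix m hm]
      exact himg.mem_tail_iff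
    have hin : σ i < n := by
      by_contra hin
      refine (hfull.trans (Set.ncard_le_ncard ?_ ?_)).not_gt hcard
      · exact fun m hm => ⟨(hsub m hm.2).2 hm.1, hm.2.trans_le (not_lt.1 hin)⟩
      · exact (Set.finite_Iio (σ i)).subset fun m hm => hm.2
    refine h k hk i hi' (lt_of_eq_of_lt ?_ hcard)
    congr 1
    ext m
    have hσi := hfix' i hin
    simp only [Set.mem_ofPred_eq, hσi]
    exact and_congr_left fun hm => (hsub m (by omega)).symm

theorem restrict_eq_of_isImage {σ : Equiv.Perm ℕ} (hfix : ∀ i < n, σ i = i)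
    (h : IsImage σ π π') : π'.restrict n = π.restrict n := by
  ext k i
  refine and_congr_left fun hi => ?_
  conv_lhs => rw [← hfix i hi]
  exact h.mem_block_iff

theorem counts_congr (h : π'.restrict n = π.restrict n) : π'.counts n = π.counts n := by
  ext k
  rw [counts, counts, h]

theorem counts_eq_of_isImage {σ : Equiv.Perm ℕ} (hfix : ∀ i, σ i < n ↔ i < n)
    (h : IsImage σ π π') : π'.counts n = π.counts n := by
  ext k
  rw [counts, counts, ← Set.ncard_image_of_injective (π.restrict n k) σ.injective]
  congr 1
  ext i'
  obtain ⟨i, rfl⟩ := σ.surjective i'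
  rw [σ.injective.mem_set_image]
  exact and_congr h.mem_block_iff (hfix i)

end NatPartition

/-- The cycle that moves `n` to the place `m ≥ n` and shifts the elements in between down by one. -/
def shiftCycle (n m : ℕ) (h : n ≤ m) : Equiv.Perm ℕ where
  toFun i := if i = n then m else if n < i ∧ i ≤ m then i - 1 else i
  invFun i := if i = m then n else if n ≤ i ∧ i < m then i + 1 else i
  left_inv i := by grind
  right_inv i := by grind

section shiftCycle

variable {n m : ℕ} (h : n ≤ m)

theorem shiftCycle_apply_self : shiftCycle n m h n = m := by simp [shiftCycle]

theorem shiftCycle_symm_apply_self : (shiftCycle n m h).symm m = n := by simp [shiftCycle]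

theorem shiftCycle_of_lt {i : ℕ} (hi : i < n) : shiftCycle n m h i = i := by
  simp only [shiftCycle, Equiv.coe_fn_mk]; grind

theorem shiftCycle_of_gt {i : ℕ} (hi : m < i) : shiftCycle n m h i = i := by
  simp only [shiftCycle, Equiv.coe_fn_mk]; grind

theorem shiftCycle_lt_iff {i N : ℕ} (hN : m < N) : shiftCycle n m h i < N ↔ i < N := by
  simp only [shiftCycle, Equiv.coe_fn_mk]; grind

theorem shiftCycle_strictMonoOn : StrictMonoOn (shiftCycle n m h) {n}ᶜ := by
  intro a ha b hb hab
  simp only [Set.mem_compl_iff, Set.mem_singleton_iff] at ha hb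
  simp only [shiftCycle, Equiv.coe_fn_mk]; grind

theorem shiftCycle_symm_strictMonoOn : StrictMonoOn (shiftCycle n m h).symm {m}ᶜ := by
  intro a ha b hb hab
  simp only [Set.mem_compl_iff, Set.mem_singleton_iff] at ha hb
  simp only [shiftCycle, Equiv.coe_fn_symm_mk]; grind

end shiftCycle

/-- The conditional probability with which the next element joins block `j`, in terms of the block
sizes `c`: blocks that have their quota get their frequency, and the first block without its quota
gets all the remaining mass. -/
noncomputable def quotaStep (ρ : ℕ → ℕ) (p : ℕ → ℝ) (c : ℕ → ℕ) (j : ℕ) : ℝ :=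
  if ρ j ≤ c j then p j
  else if ∀ i < j, ρ i ≤ c i then 1 - ∑ i ∈ Finset.range j, p i else 0

theorem stepProb_shape {ρ : ℕ → ℕ} (hρ : ∀ k, 1 ≤ ρ k) {π : NatPartition}
    (h : π.IsConstrained ρ) (p : ℕ → ℝ) {n : ℕ} (hn : 1 ≤ n) (j : ℕ) :
    stepProb ρ p (π.shape n) j = quotaStep ρ p (π.counts n) j := by
  obtain ⟨L, hL, hs⟩ := π.shape_eq_map_range n
  have hlen : (π.shape n).length = L := by simp [hs]
  have hL1 : 0 < L := (hL 0).1 (NatPartition.counts_zero_pos hn)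
  have hquota : ∀ i, i + 1 < L → ρ i ≤ π.counts n i := fun i hi =>
    h.le_counts i.lt_succ_self ((hL _).2 hi)
  have hzero : ∀ i, L ≤ i → ¬ ρ i ≤ π.counts n i := fun i hi hle =>
    absurd ((hL i).1 ((hρ i).trans hle)) (not_lt.2 hi)
  rw [stepProb, quotaStep, hlen, NatPartition.shape_getD]
  rcases lt_trichotomy (j + 1) L with hj | hj | hj
  · rw [if_pos hj, if_pos (hquota j hj)]
  · have hjL : L - 1 = j := by omega
    have hall : ∀ i < j, ρ i ≤ π.counts n i := fun i hi => hquota i (by omega)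
    rw [hjL, if_neg (by omega), if_pos hj, if_pos hj, if_pos hall]
    split_ifs <;> first | rfl | omega
  · rw [if_neg (by omega), if_neg (hzero j (by omega)), if_neg (by omega : ¬ j + 1 = L),
      if_neg (by omega : ¬ j + 1 = L)]
    have hiff : (∀ i < j, ρ i ≤ π.counts n i) ↔
        ¬ π.counts n (L - 1) < ρ (L - 1) ∧ j = L := by
      refine ⟨fun hall => ?_, fun ⟨h1, h2⟩ i hi => ?_⟩
      · refine ⟨not_lt.2 (hall _ (by omega)), ?_⟩
        by_contra hne
        exact hzero L le_rfl (hall L (by omega))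
      · rcases lt_or_ge (i + 1) L with hi' | hi'
        · exact hquota i hi'
        · rw [show i = L - 1 by omega]
          exact not_lt.1 h1
    split_ifs <;> first | rfl | tauto

open MeasureTheory Filter Topology

/-! ### Averages of variables with constant pair correlations -/

section Averages

variable {Ω : Type*} [MeasurableSpace Ω] {ν : Measure Ω} [IsFiniteMeasure ν]
  {ξ : ℕ → Ω → ℝ} {α β : ℝ}

theorem integrable_mul_of_mem_Icc (hm : ∀ i, Measurable (ξ i)) (h0 : ∀ i ω, 0 ≤ ξ i ω)
    (h1 : ∀ i ω, ξ i ω ≤ 1) (i k : ℕ) : Integrable (fun ω => ξ i ω * ξ k ω) ν := by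
  refine Integrable.of_bound ((hm i).mul (hm k)).aestronglyMeasurable 1 (ae_of_all _ fun ω => ?_)
  rw [Real.norm_of_nonneg (mul_nonneg (h0 i ω) (h0 k ω))]
  exact mul_le_one₀ (h1 i ω) (h0 k ω) (h1 k ω)

/-- For variables with constant second moments and constant pair correlations, the second moment
of a linear combination whose coefficients sum to zero. -/
theorem integral_sq_sum_of_sum_eq_zero (hm : ∀ i, Measurable (ξ i)) (h0 : ∀ i ω, 0 ≤ ξ i ω)
    (h1 : ∀ i ω, ξ i ω ≤ 1) (hα : ∀ i, ∫ ω, ξ i ω * ξ i ω ∂ν = α)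
    (hβ : ∀ i k, i ≠ k → ∫ ω, ξ i ω * ξ k ω ∂ν = β) (m : ℕ) (w : ℕ → ℝ)
    (hw : ∑ i ∈ Finset.range m, w i = 0) :
    ∫ ω, (∑ i ∈ Finset.range m, w i * ξ i ω) ^ 2 ∂ν =
      (α - β) * ∑ i ∈ Finset.range m, w i ^ 2 := by
  have hint := integrable_mul_of_mem_Icc (ν := ν) hm h0 h1
  have hcov : ∀ i k, ∫ ω, ξ i ω * ξ k ω ∂ν = β + if i = k then α - β else 0 := fun i k => by
    split_ifs with h
    · subst h; rw [hα]; ring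
    · rw [hβ i k h, add_zero]
  have : ∀ ω, (∑ i ∈ Finset.range m, w i * ξ i ω) ^ 2 =
      ∑ i ∈ Finset.range m, ∑ k ∈ Finset.range m, w i * w k * (ξ i ω * ξ k ω) := fun ω => by
    rw [sq, Finset.sum_mul_sum]
    exact Finset.sum_congr rfl fun i _ => Finset.sum_congr rfl fun k _ => by ring
  simp_rw [this]
  rw [integral_finsetSum _ fun i _ => integrable_finsetSum _ fun k _ => (hint i k).const_mul _]
  have hinner : ∀ i, ∫ ω, ∑ k ∈ Finset.range m, w i * w k * (ξ i ω * ξ k ω) ∂ν =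
      ∑ k ∈ Finset.range m, w i * w k * (β + if i = k then α - β else 0) := fun i => by
    rw [integral_finsetSum _ fun k _ => (hint i k).const_mul _]
    simp_rw [integral_const_mul, hcov]
  simp_rw [hinner, mul_add, Finset.sum_add_distrib]
  have hzero : ∑ i ∈ Finset.range m, ∑ k ∈ Finset.range m, w i * w k * β = 0 := by
    simp only [← Finset.sum_mul, ← Finset.mul_sum, hw, mul_zero, zero_mul, Finset.sum_const_zero]
  rw [hzero, zero_add, Finset.mul_sum]
  refine Finset.sum_congr rfl fun i hi => ?_
  simp only [mul_ite, mul_zero, Finset.sum_ite_eq, hi, if_true]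
  ring

theorem integral_sq_average_sub_average (hm : ∀ i, Measurable (ξ i)) (h0 : ∀ i ω, 0 ≤ ξ i ω)
    (h1 : ∀ i ω, ξ i ω ≤ 1) (hα : ∀ i, ∫ ω, ξ i ω * ξ i ω ∂ν = α)
    (hβ : ∀ i k, i ≠ k → ∫ ω, ξ i ω * ξ k ω ∂ν = β) {n m : ℕ} (hn : 0 < n) (hnm : n ≤ m) :
    ∫ ω, ((∑ i ∈ Finset.range n, ξ i ω) / n - (∑ i ∈ Finset.range m, ξ i ω) / m) ^ 2 ∂ν =
      (α - β) * (1 / n - 1 / m) := by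
  have hn' : (n : ℝ) ≠ 0 := by positivity
  have hm' : (m : ℝ) ≠ 0 := by
    have : 0 < m := hn.trans_le hnm
    positivity
  set w : ℕ → ℝ := fun i => (if i < n then 1 / (n : ℝ) else 0) - 1 / m with hwdef
  have hfilter : (Finset.range m).filter (· < n) = Finset.range n := by
    ext i; simp; omega
  have hcomb : ∀ ω, (∑ i ∈ Finset.range n, ξ i ω) / n - (∑ i ∈ Finset.range m, ξ i ω) / m =
      ∑ i ∈ Finset.range m, w i * ξ i ω := fun ω => by
    simp only [hwdef, sub_mul, Finset.sum_sub_distrib, ite_mul, zero_mul]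
    rw [← Finset.sum_filter, hfilter, ← Finset.mul_sum, ← Finset.mul_sum]
    ring
  have hw : ∑ i ∈ Finset.range m, w i = 0 := by
    simp only [hwdef, Finset.sum_sub_distrib]
    rw [← Finset.sum_filter, hfilter]
    simp [hn', hm']
  have hw2 : ∑ i ∈ Finset.range m, w i ^ 2 = 1 / n - 1 / m := by
    have : ∀ i, w i ^ 2 =
        (if i < n then 1 / (n : ℝ) ^ 2 - 2 / (n * m) else 0) + 1 / (m : ℝ) ^ 2 := fun i => by
      simp only [hwdef]
      split_ifs <;> field_simp <;> ring
    simp only [this, Finset.sum_add_distrib]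
    rw [← Finset.sum_filter, hfilter]
    simp only [Finset.sum_const, Finset.card_range, nsmul_eq_mul]
    field_simp
    ring
  simp_rw [hcomb]
  rw [integral_sq_sum_of_sum_eq_zero hm h0 h1 hα hβ m w hw, hw2]

/-- A strong law of large numbers for bounded nonnegative variables with constant second moments
and constant pair correlations, in particular for exchangeable events. -/
theorem ae_exists_tendsto_average (hm : ∀ i, Measurable (ξ i)) (h0 : ∀ i ω, 0 ≤ ξ i ω)
    (h1 : ∀ i ω, ξ i ω ≤ 1) (hα : ∀ i, ∫ ω, ξ i ω * ξ i ω ∂ν = α)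
    (hβ : ∀ i k, i ≠ k → ∫ ω, ξ i ω * ξ k ω ∂ν = β) :
    ∀ᵐ ω ∂ν, ∃ l, Tendsto (fun n : ℕ => (∑ i ∈ Finset.range n, ξ i ω) / n) atTop (𝓝 l) := by
  set S : ℕ → Ω → ℝ := fun n ω => ∑ i ∈ Finset.range n, ξ i ω with hS
  have hSm : ∀ n, Measurable (S n) := fun n => Finset.measurable_fun_sum _ fun i _ => hm i
  -- along fourth powers the increments of the averages are summable
  set c : ℕ → ℕ := fun k => (k + 1) ^ 4 with hc
  set Δ : ℕ → Ω → ℝ := fun k ω => S (c k) ω / c k - S (c (k + 1)) ω / c (k + 1) with hΔ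
  set f : ℕ → Ω → ℝ := fun k ω => ((k : ℝ) + 1) ^ 2 * Δ k ω ^ 2 with hf
  have hf0 : ∀ k ω, 0 ≤ f k ω := fun k ω => by positivity
  have hfm : ∀ k, Measurable (f k) := fun k =>
    ((((hSm _).div_const _).sub ((hSm _).div_const _)).pow_const 2).const_mul _
  have hΔle : ∀ k ω, |Δ k ω| ≤ 2 := fun k ω => by
    have havg : ∀ n, 0 ≤ S n ω / n ∧ S n ω / n ≤ 1 := fun n => by
      refine ⟨div_nonneg (Finset.sum_nonneg fun i _ => h0 i ω) n.cast_nonneg,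
        div_le_one_of_le₀ ?_ n.cast_nonneg⟩
      simpa using Finset.sum_le_sum fun i (_ : i ∈ Finset.range n) => h1 i ω
    have ha := havg (c k)
    have hb := havg (c (k + 1))
    rw [abs_le]
    constructor <;> simp only [hΔ] <;> linarith
  have hfi : ∀ k, Integrable (f k) ν := fun k => by
    refine Integrable.of_bound (hfm k).aestronglyMeasurable (((k : ℝ) + 1) ^ 2 * 2 ^ 2)
      (ae_of_all _ fun ω => ?_)
    rw [Real.norm_of_nonneg (hf0 k ω)]
    refine mul_le_mul_of_nonneg_left ?_ (by positivity)
    rw [← sq_abs]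
    exact pow_le_pow_left₀ (abs_nonneg _) (hΔle k ω) 2
  have hcc : ∀ k, c k ≤ c (k + 1) := fun k => Nat.pow_le_pow_left (by omega) 4
  have hαβ : 0 ≤ α - β := by
    have h := integral_sq_average_sub_average (ν := ν) hm h0 h1 hα hβ zero_lt_one one_le_two
    have : 0 ≤ ∫ ω, ((∑ i ∈ Finset.range 1, ξ i ω) / (1 : ℕ) -
        (∑ i ∈ Finset.range 2, ξ i ω) / (2 : ℕ)) ^ 2 ∂ν := integral_nonneg fun ω => sq_nonneg _
    rw [h] at this
    norm_num at this
    linarith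
  have hfint : ∀ k, ∫ ω, f k ω ∂ν ≤ (α - β) * (1 / ((k : ℝ) + 1) ^ 2) := fun k => by
    simp only [hf, hΔ]
    rw [integral_const_mul, integral_sq_average_sub_average hm h0 h1 hα hβ (by positivity) (hcc k)]
    have hck : (c k : ℝ) = ((k : ℝ) + 1) ^ 4 := by simp [hc]
    have h2 : (0 : ℝ) ≤ 1 / (c (k + 1) : ℝ) := by positivity
    calc ((k : ℝ) + 1) ^ 2 * ((α - β) * (1 / c k - 1 / c (k + 1)))
        ≤ ((k : ℝ) + 1) ^ 2 * ((α - β) * (1 / c k)) := by gcongr; linarith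
      _ = _ := by rw [hck]; field_simp
  have hsum2 : Summable fun k : ℕ => 1 / ((k : ℝ) + 1) ^ 2 := by
    have := (summable_nat_add_iff 1).2 (Real.summable_one_div_nat_pow.2 one_lt_two)
    simpa using this
  have hfsum : ∀ᵐ ω ∂ν, Summable fun k => f k ω := by
    have hlt : ∫⁻ ω, ∑' k, ENNReal.ofReal (f k ω) ∂ν ≠ ⊤ := by
      rw [lintegral_tsum fun k => (hfm k).ennreal_ofReal.aemeasurable]
      simp_rw [← ofReal_integral_eq_lintegral_ofReal (hfi _) (ae_of_all _ (hf0 _))]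
      have hs : Summable fun k => ∫ ω, f k ω ∂ν :=
        Summable.of_nonneg_of_le (fun k => integral_nonneg (hf0 k)) hfint (hsum2.mul_left _)
      exact hs.tsum_ofReal_ne_top
    have hmt : Measurable fun ω => ∑' k, ENNReal.ofReal (f k ω) :=
      Measurable.tsum fun k => (hfm k).ennreal_ofReal
    filter_upwards [ae_lt_top hmt hlt] with ω hω
    have := ENNReal.summable_toReal hω.ne
    simpa [ENNReal.toReal_ofReal (hf0 _ _)] using this
  filter_upwards [hfsum] with ω hω
  have hcauchy : CauchySeq fun k => S (c k) ω / c k := by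
    refine cauchySeq_of_summable_dist
      (Summable.of_nonneg_of_le (fun k => dist_nonneg) (fun k => ?_) (hsum2.add hω))
    have hk : (0 : ℝ) < (k : ℝ) + 1 := by positivity
    rw [Real.dist_eq]
    change |Δ k ω| ≤ 1 / ((k : ℝ) + 1) ^ 2 + ((k : ℝ) + 1) ^ 2 * Δ k ω ^ 2
    -- `2 x y ≤ x² + y²` with `x = 1 / (k + 1)` and `y = (k + 1) |Δ k|`
    have h2 := two_mul_le_add_sq (1 / ((k : ℝ) + 1)) (((k : ℝ) + 1) * |Δ k ω|)
    rw [mul_pow, sq_abs, div_pow, one_pow] at h2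
    have h3 : 2 * (1 / ((k : ℝ) + 1)) * (((k : ℝ) + 1) * |Δ k ω|) = 2 * |Δ k ω| := by
      field_simp
    have := abs_nonneg (Δ k ω)
    linarith
  obtain ⟨l, hl⟩ := cauchySeq_tendsto_of_complete hcauchy
  refine ⟨l, tendsto_div_of_monotone_of_exists_subseq_tendsto_div (fun n => S n ω) l ?_
    fun a ha => ⟨c, ?_, ?_, hl⟩⟩
  · exact monotone_nat_of_le_succ fun n => by
      simp only [hS, Finset.sum_range_succ]
      linarith [h0 n ω]
  · have hlim : Tendsto (fun k : ℕ => (1 + 1 / ((k : ℝ) + 1)) ^ 4) atTop (𝓝 ((1 + 0) ^ 4)) :=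
      (tendsto_one_div_add_atTop_nhds_zero_nat.const_add 1).pow 4
    rw [add_zero, one_pow] at hlim
    filter_upwards [hlim.eventually_le_const ha] with k hk
    have hk' : (0 : ℝ) < (k : ℝ) + 1 := by positivity
    have heq : (c (k + 1) : ℝ) = (1 + 1 / ((k : ℝ) + 1)) ^ 4 * c k := by
      simp only [hc]
      push_cast
      field_simp
    rw [heq]
    gcongr
  · exact tendsto_atTop_mono (fun k => (Nat.le_succ k).trans (Nat.le_self_pow (by norm_num) _))
      tendsto_id

end Averages

/-! ### Measurability and frequencies -/

namespace NatPartition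

theorem measurable_block : Measurable block := comap_measurable _

theorem measurable_mem_block (i k : ℕ) : Measurable fun π : NatPartition => i ∈ π.block k :=
  (measurable_set_mem i).comp ((measurable_pi_apply k).comp measurable_block)

theorem measurableSet_mem_block (i k : ℕ) : MeasurableSet {π : NatPartition | i ∈ π.block k} :=
  measurableSet_setOfPred.2 (measurable_mem_block i k)

theorem measurable_restrict (n : ℕ) : Measurable fun π : NatPartition => π.restrict n :=
  measurable_pi_iff.2 fun k => measurable_set_iff.2 fun i =>
    (measurable_mem_block i k).and measurable_const

theorem measurable_ncard_inter_Iio (n : ℕ) : Measurable fun s : Set ℕ => (s ∩ Set.Iio n).ncard := by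
  classical
  have : ∀ s : Set ℕ, (s ∩ Set.Iio n).ncard = ∑ i ∈ Finset.range n, if i ∈ s then 1 else 0 := by
    intro s
    have : s ∩ Set.Iio n = ((Finset.range n).filter (· ∈ s) : Finset ℕ) := by
      ext i; simp [and_comm]
    rw [this, Set.ncard_coe_finset, Finset.card_filter]
  simp_rw [this]
  exact Finset.measurable_fun_sum _ fun i _ =>
    Measurable.ite (measurableSet_setOfPred.2 (measurable_set_mem i)) measurable_const
      measurable_const

theorem measurable_counts (n : ℕ) : Measurable fun π : NatPartition => π.counts n :=
  measurable_pi_iff.2 fun k =>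
    (measurable_ncard_inter_Iio n).comp ((measurable_pi_apply k).comp measurable_block)

theorem measurableSet_isConstrained (ρ : ℕ → ℕ) :
    MeasurableSet {π : NatPartition | π.IsConstrained ρ} := by
  have htail : ∀ i k, Measurable fun π : NatPartition => i ∈ π.tail k := fun i k => by
    simp_rw [mem_tail_iff]
    exact Measurable.exists fun j => measurable_const.and (measurable_mem_block i j)
  have hcard : ∀ i k, Measurable fun π : NatPartition => {m ∈ π.tail k | m < i}.ncard :=
    fun i k => (measurable_ncard_inter_Iio i).comp (measurable_set_iff.2 fun m => htail m k)
  refine measurableSet_setOfPred.2 (Measurable.forall fun k => Measurable.imp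
    (Measurable.exists fun i => measurable_mem_block i k) (Measurable.forall fun i =>
      Measurable.imp (htail i k) (Measurable.imp ?_ (measurable_mem_block i k))))
  exact measurableSet_setOfPred.1 (measurableSet_lt (hcard i k) measurable_const)

variable {π π' : NatPartition} {ρ : ℕ → ℕ} {n m i j k : ℕ}

/-- The asymptotic frequency of block `k`, with the value `0` where the limit does not exist. -/
noncomputable def freq (π : NatPartition) (k : ℕ) : ℝ :=
  open Classical in
  if ∃ l, Tendsto (fun n : ℕ => (π.counts n k : ℝ) / n) atTop (𝓝 l) then
    limsup (fun n : ℕ => (π.counts n k : ℝ) / n) atTop else 0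

theorem tendsto_freq (h : ∃ l, Tendsto (fun n : ℕ => (π.counts n k : ℝ) / n) atTop (𝓝 l)) :
    Tendsto (fun n : ℕ => (π.counts n k : ℝ) / n) atTop (𝓝 (π.freq k)) := by
  rw [freq, if_pos h]
  obtain ⟨l, hl⟩ := h
  rwa [hl.limsup_eq]

theorem measurable_freq : Measurable freq := by
  have hm : ∀ n k : ℕ, Measurable fun π : NatPartition => (π.counts n k : ℝ) / n := fun n k =>
    (measurable_from_top.comp ((measurable_pi_apply k).comp (measurable_counts n))).div_const _
  exact measurable_pi_iff.2 fun k => Measurable.ite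
    (measurableSet_exists_tendsto fun n => hm n k) (Measurable.limsup fun n => hm n k)
    measurable_const

theorem freq_nonneg (π : NatPartition) (k : ℕ) : 0 ≤ π.freq k := by
  by_cases h : ∃ l, Tendsto (fun n : ℕ => (π.counts n k : ℝ) / n) atTop (𝓝 l)
  · exact ge_of_tendsto' (tendsto_freq h) fun n => by positivity
  · rw [freq, if_neg h]

theorem sum_freq_le_one (π : NatPartition) (s : Finset ℕ) : ∑ k ∈ s, π.freq k ≤ 1 := by
  classical
  set t := s.filter fun k => ∃ l, Tendsto (fun n : ℕ => (π.counts n k : ℝ) / n) atTop (𝓝 l)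
    with ht
  have hst : ∑ k ∈ s, π.freq k = ∑ k ∈ t, π.freq k := by
    rw [ht, Finset.sum_filter]
    refine Finset.sum_congr rfl fun k _ => ?_
    split_ifs with h
    · rfl
    · rw [freq, if_neg h]
  rw [hst]
  refine le_of_tendsto' (tendsto_finsetSum t fun k hk => tendsto_freq (Finset.mem_filter.1 hk).2)
    fun n => ?_
  rw [← Finset.sum_div]
  refine div_le_one_of_le₀ ?_ n.cast_nonneg
  obtain ⟨J, hJ⟩ := t.exists_nat_subset_range
  calc ∑ k ∈ t, (π.counts n k : ℝ)
      ≤ ∑ k ∈ Finset.range (max J n), (π.counts n k : ℝ) :=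
        Finset.sum_le_sum_of_subset_of_nonneg
          (hJ.trans (Finset.range_mono (le_max_left _ _))) fun _ _ _ => Nat.cast_nonneg _
    _ = n := by exact_mod_cast π.sum_counts (le_max_right J n)

theorem freq_le_one (π : NatPartition) (k : ℕ) : π.freq k ≤ 1 := by
  simpa using π.sum_freq_le_one {k}

theorem summable_freq (π : NatPartition) : Summable π.freq :=
  summable_of_sum_le π.freq_nonneg π.sum_freq_le_one

theorem tsum_freq_le_one (π : NatPartition) : ∑' k, π.freq k ≤ 1 :=
  π.summable_freq.tsum_le_of_sum_le π.sum_freq_le_one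

theorem freq_eq_of_counts_eq {N : ℕ} (h : ∀ n, N ≤ n → π'.counts n = π.counts n) :
    π'.freq = π.freq := by
  ext k
  have heq : (fun n : ℕ => (π'.counts n k : ℝ) / n) =ᶠ[atTop]
      fun n : ℕ => (π.counts n k : ℝ) / n :=
    (eventually_ge_atTop N).mono fun n hn => by simp only [h n hn]
  have hiff : (∃ l, Tendsto (fun n : ℕ => (π'.counts n k : ℝ) / n) atTop (𝓝 l)) ↔
      ∃ l, Tendsto (fun n : ℕ => (π.counts n k : ℝ) / n) atTop (𝓝 l) :=
    exists_congr fun l => tendsto_congr' heq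
  classical
  rw [freq, freq, limsup_congr heq]
  exact if_congr hiff rfl rfl

end NatPartition

/-! ### Invariance under moving one element -/

section Move

open NatPartition

variable {Ω : Type*} [MeasurableSpace Ω] {μ : Measure Ω} {ρ : ℕ → ℕ} {X : Ω → NatPartition}

/-- Within an event `E` on which block `j` has its quota by time `n`, and which is insensitive to
moving the element `n` to the place `m`, the elements `n` and `m` belong to block `j` with equal
probabilities. -/
theorem IsConstrainedExchangeable.measure_mem_block_eq (hρ : ∀ k, 1 ≤ ρ k)
    (hexch : IsConstrainedExchangeable μ ρ X) {n m j : ℕ} (hnm : n ≤ m) {E : Set NatPartition}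
    (hE : MeasurableSet E) (hquota : ∀ π ∈ E, ρ j ≤ π.counts n j)
    (hinv : ∀ π π', IsImage (shiftCycle n m hnm) π π' → (π ∈ E ↔ π' ∈ E)) :
    μ (X ⁻¹' E ∩ {ω | n ∈ (X ω).block j}) = μ (X ⁻¹' E ∩ {ω | m ∈ (X ω).block j}) := by
  set σ := shiftCycle n m hnm with hσ
  have hfix : ∀ i < n, σ i = i := fun i hi => shiftCycle_of_lt hnm hi
  have key := hexch.2 σ ({π | π.IsConstrained ρ} ∩ (E ∩ {π | n ∈ π.block j}))
    ({π | π.IsConstrained ρ} ∩ (E ∩ {π | m ∈ π.block j}))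
    ((measurableSet_isConstrained ρ).inter (hE.inter (measurableSet_mem_block n j)))
    ((measurableSet_isConstrained ρ).inter (hE.inter (measurableSet_mem_block m j)))
    (fun π h => h.1) (fun π h => h.1) ?_ ?_
  · have hae : ∀ s : Set NatPartition,
        μ (X ⁻¹' ({π | π.IsConstrained ρ} ∩ s)) = μ (X ⁻¹' s) := fun s => by
      refine measure_congr ?_
      filter_upwards [hexch.1] with ω hω
      exact propext ⟨fun h => h.2, fun h => ⟨hω, h⟩⟩
    rw [hae, hae] at key
    exact key
  · rintro π ⟨hπ, hπE, hn⟩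
    obtain ⟨π', hπ', himg⟩ := IsConstrained.exists_isImage hρ hπ (hquota π hπE) hn le_rfl hfix
      (shiftCycle_strictMonoOn hnm)
    refine ⟨π', ⟨hπ', (hinv π π' himg).1 hπE, ?_⟩, himg⟩
    have := himg.mem_block_iff.2 hn
    rwa [hσ, shiftCycle_apply_self] at this
  · rintro π' ⟨hπ', hπE, hm⟩
    have hfix' : ∀ i < n, σ.symm i = i := fun i hi => by
      rw [Equiv.symm_apply_eq, hfix i hi]
    obtain ⟨π, hπ, himg⟩ := IsConstrained.exists_isImage hρ hπ' (hquota π' hπE) hm hnm hfix'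
      (shiftCycle_symm_strictMonoOn hnm)
    have himg' : IsImage σ π π' := fun k => by
      rw [himg k, ← Set.image_comp]
      simp
    refine ⟨π, ⟨hπ, (hinv π π' himg').2 hπE, ?_⟩, himg'⟩
    have := himg.mem_block_iff.2 hm
    rwa [hσ, shiftCycle_symm_apply_self] at this

end Move

/-! ### Existence of the frequencies -/

section Frequencies

open NatPartition

variable {Ω : Type*} [MeasurableSpace Ω] {μ : Measure Ω} [IsProbabilityMeasure μ]
  {ρ : ℕ → ℕ} {X : Ω → NatPartition}

theorem measurableSet_mem_block_comp (hX : Measurable X) (n j : ℕ) :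
    MeasurableSet {ω | n ∈ (X ω).block j} :=
  hX (measurableSet_mem_block n j)

theorem measurableSet_quota (ρ : ℕ → ℕ) (n j : ℕ) :
    MeasurableSet {π : NatPartition | ρ j ≤ π.counts n j} :=
  measurableSet_le measurable_const ((measurable_pi_apply j).comp (measurable_counts n))

/-- A block that gets its quota has a frequency: afterwards, the events that it contains the
subsequent elements have constant probabilities and constant pair correlations. -/
theorem IsConstrainedExchangeable.ae_exists_tendsto_of_quota (hρ : ∀ k, 1 ≤ ρ k)
    (hX : Measurable X) (hexch : IsConstrainedExchangeable μ ρ X) (n j : ℕ) :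
    ∀ᵐ ω ∂μ, ρ j ≤ (X ω).counts n j →
      ∃ l, Tendsto (fun N : ℕ => ((X ω).counts N j : ℝ) / N) atTop (𝓝 l) := by
  set D : Set NatPartition := {π | ρ j ≤ π.counts n j} with hD
  have hDm : MeasurableSet D := measurableSet_quota ρ n j
  have hDX : MeasurableSet (X ⁻¹' D) := hX hDm
  let A : ℕ → Set Ω := fun i => {ω | n + i ∈ (X ω).block j}
  have hA : ∀ i, MeasurableSet (A i) := fun i => measurableSet_mem_block_comp hX _ _
  let ξ : ℕ → Ω → ℝ := fun i => (A i).indicator 1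
  have hDinv : ∀ m (h : n ≤ m) π π', IsImage (shiftCycle n m h) π π' → (π ∈ D ↔ π' ∈ D) :=
    fun m h π π' himg => by
      simp only [hD, Set.mem_ofPred_eq,
        counts_congr (restrict_eq_of_isImage (fun i => shiftCycle_of_lt h) himg)]
  have hα : ∀ i, μ.real (X ⁻¹' D ∩ A i) = μ.real (X ⁻¹' D ∩ A 0) := fun i => by
    have := hexch.measure_mem_block_eq hρ (Nat.le_add_right n i) hDm (fun π hπ => hπ) (hDinv _ _)
    exact (congrArg ENNReal.toReal this).symm
  have hβ1 : ∀ i k, i < k →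
      μ.real (X ⁻¹' D ∩ (A i ∩ A k)) = μ.real (X ⁻¹' D ∩ (A 0 ∩ A k)) := fun i k hik => by
    have := hexch.measure_mem_block_eq hρ (Nat.le_add_right n i)
      (hDm.inter (measurableSet_mem_block (n + k) j)) (fun π hπ => hπ.1) fun π π' himg => by
        refine and_congr (hDinv _ _ π π' himg) ?_
        have := himg.mem_block_iff (i := n + k) (k := j)
        rw [shiftCycle_of_gt _ (by omega)] at this
        exact this.symm
    have h2 : ∀ i, X ⁻¹' D ∩ (A i ∩ A k) = X ⁻¹' (D ∩ {π | n + k ∈ π.block j}) ∩ A i :=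
      fun i => by rw [Set.inter_comm (A i), ← Set.inter_assoc]; rfl
    rw [h2, h2]
    exact (congrArg ENNReal.toReal this).symm
  have hβ2 : ∀ k, 0 < k →
      μ.real (X ⁻¹' D ∩ (A 0 ∩ A k)) = μ.real (X ⁻¹' D ∩ (A 0 ∩ A 1)) := fun k hk => by
    have := hexch.measure_mem_block_eq hρ (n := n + 1) (m := n + k) (j := j) (by omega)
      (hDm.inter (measurableSet_mem_block n j))
      (fun π hπ => hπ.1.trans (π.counts_mono j n.le_succ)) fun π π' himg => by
        have hfix : ∀ i < n + 1, shiftCycle (n + 1) (n + k) (by omega) i = i :=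
          fun i hi => shiftCycle_of_lt _ hi
        refine and_congr ?_ ?_
        · simp only [hD, Set.mem_ofPred_eq,
            counts_congr (n := n) (restrict_eq_of_isImage (fun i hi => hfix i (by omega)) himg)]
        · have := himg.mem_block_iff (i := n) (k := j)
          rw [hfix n n.lt_succ_self] at this
          exact this.symm
    have h2 : ∀ k, X ⁻¹' D ∩ (A 0 ∩ A k) = X ⁻¹' (D ∩ {π | n ∈ π.block j}) ∩ A k :=
      fun k => by rw [← Set.inter_assoc]; rfl
    rw [h2, h2]
    exact (congrArg ENNReal.toReal this).symm
  have hξ : ∀ i k, ∫ ω, ξ i ω * ξ k ω ∂(μ.restrict (X ⁻¹' D)) =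
      μ.real (X ⁻¹' D ∩ (A i ∩ A k)) := fun i k => by
    have : (fun ω => ξ i ω * ξ k ω) = (A i ∩ A k).indicator 1 := by
      ext ω
      rw [Set.inter_indicator_one]
      rfl
    rw [this, integral_indicator_one ((hA i).inter (hA k)),
      measureReal_restrict_apply ((hA i).inter (hA k)), Set.inter_comm]
  have hlim := ae_exists_tendsto_average (ν := μ.restrict (X ⁻¹' D)) (ξ := ξ)
    (α := μ.real (X ⁻¹' D ∩ A 0)) (β := μ.real (X ⁻¹' D ∩ (A 0 ∩ A 1)))
    (fun i => measurable_one.indicator (hA i))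
    (fun i ω => Set.indicator_nonneg (fun _ _ => zero_le_one) ω)
    (fun i ω => Set.indicator_le_self' (fun _ _ => zero_le_one) ω)
    (fun i => by rw [hξ, Set.inter_self, hα])
    (fun i k hik => by
      rw [hξ]
      rcases hik.lt_or_gt with h | h
      · rw [hβ1 i k h, hβ2 k (by omega)]
      · rw [Set.inter_comm (A i), hβ1 k i h, hβ2 i (by omega)])
  rw [ae_restrict_iff' hDX] at hlim
  filter_upwards [hlim] with ω hω hquota
  obtain ⟨l, hl⟩ := hω hquota
  refine ⟨l, (tendsto_add_atTop_iff_nat n).1 ?_⟩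
  have hcounts : ∀ N : ℕ, ((X ω).counts (N + n) j : ℝ) =
      (X ω).counts n j + ∑ i ∈ Finset.range N, ξ i ω := fun N => by
    rw [counts_eq_sum, counts_eq_sum, add_comm N n, Finset.sum_range_add]
    rfl
  -- dividing by `N + n` instead of `N` makes no difference in the limit
  have hratio : Tendsto (fun N : ℕ => (N : ℝ) / ((N + n : ℕ) : ℝ)) atTop (𝓝 1) := by
    simpa using tendsto_natCast_div_add_atTop (𝕜 := ℝ) (n : ℝ)
  have hconst : Tendsto (fun N : ℕ => ((X ω).counts n j : ℝ) / ((N + n : ℕ) : ℝ)) atTop (𝓝 0) :=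
    (tendsto_const_div_atTop_nhds_zero_nat _).comp (tendsto_add_atTop_nat n)
  have hprod := hconst.add (hl.mul hratio)
  rw [mul_one, zero_add] at hprod
  refine hprod.congr' ((eventually_gt_atTop 0).mono fun N hN => ?_)
  have : (N : ℝ) ≠ 0 := by positivity
  have : ((N + n : ℕ) : ℝ) ≠ 0 := by positivity
  simp only [hcounts]
  field_simp

theorem IsConstrainedExchangeable.ae_tendsto_freq (hρ : ∀ k, 1 ≤ ρ k)
    (hX : Measurable X) (hexch : IsConstrainedExchangeable μ ρ X) :
    ∀ᵐ ω ∂μ, ∀ j,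
      Tendsto (fun N : ℕ => ((X ω).counts N j : ℝ) / N) atTop (𝓝 ((X ω).freq j)) := by
  have h := ae_all_iff.2 fun n => ae_all_iff.2 fun j =>
    hexch.ae_exists_tendsto_of_quota hρ hX n j
  filter_upwards [h] with ω hω j
  refine tendsto_freq ?_
  by_cases hq : ∃ n, ρ j ≤ (X ω).counts n j
  · obtain ⟨n, hn⟩ := hq
    exact hω n j hn
  · -- a block that never gets its quota is finite
    push Not at hq
    refine ⟨0, squeeze_zero (fun N => by positivity) (fun N => ?_)
      (tendsto_const_div_atTop_nhds_zero_nat (ρ j : ℝ))⟩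
    have := (hq N).le
    gcongr

/-! ### The conditional law of the next element -/

/-- The `σ`-algebra generated by the frequencies and the restriction to the first `n` elements. -/
noncomputable abbrev historySpace {Ω : Type*} (X : Ω → NatPartition) (n : ℕ) :
    MeasurableSpace Ω :=
  MeasurableSpace.comap (fun ω => ((X ω).freq, (X ω).restrict n)) inferInstance

theorem historySpace_le (hX : Measurable X) (n : ℕ) : historySpace X n ≤ ‹MeasurableSpace Ω› :=
  ((measurable_freq.comp hX).prodMk ((measurable_restrict n).comp hX)).comap_le

theorem measurable_freq_historySpace {Ω : Type*} (X : Ω → NatPartition) (n : ℕ) :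
    Measurable[historySpace X n] fun ω => (X ω).freq :=
  measurable_fst.comp (comap_measurable fun ω => ((X ω).freq, (X ω).restrict n))

theorem measurable_counts_historySpace {Ω : Type*} (X : Ω → NatPartition) (n : ℕ) :
    Measurable[historySpace X n] fun ω => (X ω).counts n := by
  have h : Measurable fun r : (ℕ → ℝ) × (ℕ → Set ℕ) => fun k => (r.2 k ∩ Set.Iio n).ncard :=
    measurable_pi_iff.2 fun k =>
      (measurable_ncard_inter_Iio n).comp ((measurable_pi_apply k).comp measurable_snd)
  have h2 := h.comp (comap_measurable fun ω => ((X ω).freq, (X ω).restrict n))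
  convert h2 using 1
  ext ω k
  simp [counts, restrict, Set.inter_assoc]

/-- A block that has its quota gets the next element with a conditional probability equal to its
frequency: the next element can be moved arbitrarily far away. -/
theorem IsConstrainedExchangeable.setIntegral_indicator_eq (hρ : ∀ k, 1 ≤ ρ k)
    (hX : Measurable X) (hexch : IsConstrainedExchangeable μ ρ X) (n j : ℕ)
    {G : Set ((ℕ → ℝ) × (ℕ → Set ℕ))} (hG : MeasurableSet G) :
    ∫ ω in X ⁻¹' ({π | ρ j ≤ π.counts n j} ∩ {π | (π.freq, π.restrict n) ∈ G}),
        {ω | n ∈ (X ω).block j}.indicator (fun _ => (1 : ℝ)) ω ∂μ =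
      ∫ ω in X ⁻¹' ({π | ρ j ≤ π.counts n j} ∩ {π | (π.freq, π.restrict n) ∈ G}),
        (X ω).freq j ∂μ := by
  set E : Set NatPartition := {π | ρ j ≤ π.counts n j} ∩ {π | (π.freq, π.restrict n) ∈ G} with hEd
  have hE : MeasurableSet E := (measurableSet_quota ρ n j).inter
    ((measurable_freq.prodMk (measurable_restrict n)) hG)
  let A : ℕ → Set Ω := fun i => {ω | i ∈ (X ω).block j}
  have hA : ∀ i, MeasurableSet (A i) := fun i => measurableSet_mem_block_comp hX _ _
  have hint : ∀ i, ∫ ω in X ⁻¹' E, (A i).indicator (fun _ => (1 : ℝ)) ω ∂μ =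
      μ.real (X ⁻¹' E ∩ A i) := fun i => by
    have := integral_indicator_one (μ := μ.restrict (X ⁻¹' E)) (hA i)
    rw [measureReal_restrict_apply (hA i), Set.inter_comm] at this
    exact this
  have hconst : ∀ m, n ≤ m → μ.real (X ⁻¹' E ∩ A m) = μ.real (X ⁻¹' E ∩ A n) := fun m hnm => by
    have := hexch.measure_mem_block_eq hρ hnm hE (fun π hπ => hπ.1) fun π π' himg => by
      have hr := restrict_eq_of_isImage (fun i => shiftCycle_of_lt hnm) himg
      have hf : π'.freq = π.freq := freq_eq_of_counts_eq (N := m + 1) fun N hN =>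
        counts_eq_of_isImage (fun i => shiftCycle_lt_iff hnm (by omega)) himg
      simp only [hEd, Set.mem_inter_iff, Set.mem_ofPred_eq, counts_congr hr, hr, hf]
    exact (congrArg ENNReal.toReal this).symm
  rw [hint]
  have hlim1 : Tendsto (fun N : ℕ => ∫ ω in X ⁻¹' E, ((X ω).counts N j : ℝ) / N ∂μ) atTop
      (𝓝 (μ.real (X ⁻¹' E ∩ A n))) := by
    have hces := (tendsto_const_nhds.congr' ((eventually_ge_atTop n).mono fun m hm =>
      (hconst m hm).symm)).cesaro
    refine hces.congr fun N => ?_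
    have : ∀ ω, ((X ω).counts N j : ℝ) / N =
        (N : ℝ)⁻¹ * ∑ i ∈ Finset.range N, (A i).indicator (fun _ => (1 : ℝ)) ω := fun ω => by
      rw [counts_eq_sum, div_eq_inv_mul]
      rfl
    simp_rw [this]
    rw [integral_const_mul, integral_finsetSum _ fun i _ =>
      (integrable_const (1 : ℝ)).indicator (hA i)]
    simp_rw [hint]
  have hlim2 : Tendsto (fun N : ℕ => ∫ ω in X ⁻¹' E, ((X ω).counts N j : ℝ) / N ∂μ) atTop
      (𝓝 (∫ ω in X ⁻¹' E, (X ω).freq j ∂μ)) := by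
    refine tendsto_integral_of_dominated_convergence (fun _ => 1) (fun N => ?_)
      (integrable_const _) (fun N => ae_of_all _ fun ω => ?_) ?_
    · exact ((measurable_from_top.comp ((measurable_pi_apply j).comp
        ((measurable_counts N).comp hX))).div_const _).aestronglyMeasurable
    · rw [Real.norm_of_nonneg (by positivity)]
      refine div_le_one_of_le₀ ?_ N.cast_nonneg
      rw [counts_eq_sum]
      simpa using Finset.sum_le_sum fun i (_ : i ∈ Finset.range N) =>
        Set.indicator_le_self' (s := (X ω).block j) (f := (1 : ℕ → ℝ)) (fun _ _ => zero_le_one) i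
    · exact ae_restrict_of_ae ((hexch.ae_tendsto_freq hρ hX).mono fun ω h => h j)
  exact tendsto_nhds_unique hlim1 hlim2

theorem integrable_freq (hX : Measurable X) (j : ℕ) : Integrable (fun ω => (X ω).freq j) μ :=
  Integrable.of_bound
    ((measurable_pi_apply j).comp (measurable_freq.comp hX)).aestronglyMeasurable 1
    (ae_of_all _ fun ω => by
      rw [Real.norm_of_nonneg (freq_nonneg _ _)]; exact freq_le_one _ _)

theorem measurableSet_quota_historySpace {Ω : Type*} (ρ : ℕ → ℕ) (X : Ω → NatPartition)
    (n j : ℕ) :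
    MeasurableSet[historySpace X n] {ω | ρ j ≤ (X ω).counts n j} :=
  ((measurable_pi_apply j).comp (measurable_counts_historySpace X n)) measurableSet_Ici

theorem IsConstrainedExchangeable.condExp_indicator_quota (hρ : ∀ k, 1 ≤ ρ k)
    (hX : Measurable X) (hexch : IsConstrainedExchangeable μ ρ X) (n j : ℕ) :
    μ[{ω | ρ j ≤ (X ω).counts n j}.indicator
        ({ω | n ∈ (X ω).block j}.indicator fun _ => (1 : ℝ)) | historySpace X n] =ᵐ[μ]
      {ω | ρ j ≤ (X ω).counts n j}.indicator fun ω => (X ω).freq j := by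
  have hle := historySpace_le hX n
  have hD := measurableSet_quota_historySpace ρ X n j
  have hιint : Integrable ({ω | n ∈ (X ω).block j}.indicator fun _ => (1 : ℝ)) μ :=
    (integrable_const _).indicator (measurableSet_mem_block_comp hX n j)
  refine (ae_eq_condExp_of_forall_setIntegral_eq hle (hιint.indicator (hle _ hD))
    (fun s _ _ => ((integrable_freq hX j).indicator (hle _ hD)).integrableOn) ?_ ?_).symm
  · rintro s ⟨G, hG, rfl⟩ -
    rw [setIntegral_indicator (hle _ hD), setIntegral_indicator (hle _ hD), Set.inter_comm]
    exact (hexch.setIntegral_indicator_eq hρ hX n j hG).symm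
  · exact (((measurable_pi_apply j).comp (measurable_freq_historySpace X n)).indicator
      hD).stronglyMeasurable.aestronglyMeasurable

/-- In a constrained partition the first block without its quota gets the next element unless one
of the preceding blocks does. -/
theorem NatPartition.IsConstrained.indicator_eq {π : NatPartition} (h : π.IsConstrained ρ)
    (n j : ℕ) (hj : ¬ ρ j ≤ π.counts n j) :
    (π.block j).indicator (fun _ => (1 : ℝ)) n =
      open Classical in
      if ∀ i < j, ρ i ≤ π.counts n i then
        1 - ∑ i ∈ Finset.range j, (π.block i).indicator (fun _ => (1 : ℝ)) n else 0 := by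
  classical
  obtain ⟨k, hk⟩ := π.exists_mem_block n
  have hind : ∀ i, (π.block i).indicator (fun _ => (1 : ℝ)) n = if i = k then 1 else 0 :=
    fun i => by
      split_ifs with hik
      · subst hik; exact Set.indicator_of_mem hk _
      · exact Set.indicator_of_notMem (fun hi => hik (eq_of_mem_block hi hk)) _
  have hquota : ∀ i < k, ρ i ≤ π.counts n i := fun i hi => by
    have := h.le_counts hi (counts_pos_iff.2 ⟨n, hk, n.lt_succ_self⟩)
    rwa [counts_succ_of_notMem fun hni => hi.ne (eq_of_mem_block hni hk)] at this
  have hkj : k ≤ j := not_lt.1 fun hlt => hj (hquota j hlt)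
  simp only [hind, Finset.sum_ite_eq', Finset.mem_range]
  rcases hkj.eq_or_lt with rfl | hkj
  · rw [if_pos hquota]; simp
  · simp [hkj, hkj.ne']

theorem IsConstrainedExchangeable.condExp_mem_block (hρ : ∀ k, 1 ≤ ρ k)
    (hX : Measurable X) (hexch : IsConstrainedExchangeable μ ρ X) (n j : ℕ) :
    μ[{ω | n ∈ (X ω).block j}.indicator (fun _ => (1 : ℝ)) | historySpace X n] =ᵐ[μ]
      fun ω => quotaStep ρ (X ω).freq ((X ω).counts n) j := by
  classical
  have hle := historySpace_le hX n
  let D : ℕ → Set Ω := fun i => {ω | ρ i ≤ (X ω).counts n i}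
  have hD : ∀ i, MeasurableSet[historySpace X n] (D i) := fun i =>
    measurableSet_quota_historySpace ρ X n i
  -- the event that `j` is the first block without its quota
  let U : Set Ω := (D j)ᶜ ∩ ⋂ i ∈ Finset.range j, D i
  have hU : MeasurableSet[historySpace X n] U :=
    (hD j).compl.inter (Finset.measurableSet_biInter _ fun i _ => hD i)
  have hUmem : ∀ ω, ω ∈ U ↔ ¬ ρ j ≤ (X ω).counts n j ∧ ∀ i < j, ρ i ≤ (X ω).counts n i :=
    fun ω => by simp [U, D]
  let f : ℕ → Ω → ℝ := fun i => (D i).indicator ({ω | n ∈ (X ω).block i}.indicator fun _ => 1)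
  let g : ℕ → Ω → ℝ := fun i => (D i).indicator fun ω => (X ω).freq i
  have hfint : ∀ i, Integrable (f i) μ := fun i =>
    ((integrable_const _).indicator (measurableSet_mem_block_comp hX n i)).indicator
      (hle _ (hD i))
  have hfg : ∀ i, μ[f i | historySpace X n] =ᵐ[μ] g i := fun i =>
    hexch.condExp_indicator_quota hρ hX n i
  let F : Ω → ℝ := (fun _ => 1) - ∑ i ∈ Finset.range j, f i
  have hFint : Integrable F μ :=
    (integrable_const _).sub (integrable_finsetSum' _ fun i _ => hfint i)
  have hF : μ[F | historySpace X n] =ᵐ[μ] (fun _ => 1) - ∑ i ∈ Finset.range j, g i := by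
    have h1 := condExp_sub (μ := μ) (integrable_const (1 : ℝ))
      (integrable_finsetSum' (Finset.range j) fun i _ => hfint i) (historySpace X n)
    have h2 := condExp_finsetSum (μ := μ) (s := Finset.range j) (fun i _ => hfint i)
      (historySpace X n)
    rw [condExp_const hle] at h1
    filter_upwards [h1, h2, ae_all_iff.2 hfg] with ω h1 h2 h3
    rw [h1, Pi.sub_apply, h2]
    simp [h3]
  have hdecomp : {ω | n ∈ (X ω).block j}.indicator (fun _ => (1 : ℝ)) =ᵐ[μ]
      f j + U.indicator F := by
    filter_upwards [hexch.1] with ω hω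
    change ((X ω).block j).indicator (fun _ => (1 : ℝ)) n = _
    have hf : ∀ i, ρ i ≤ (X ω).counts n i →
        f i ω = ((X ω).block i).indicator (fun _ => (1 : ℝ)) n := fun i hi =>
      Set.indicator_of_mem (s := D i) hi _
    by_cases hj : ρ j ≤ (X ω).counts n j
    · rw [Pi.add_apply, hf j hj, Set.indicator_of_notMem (fun h => ((hUmem ω).1 h).1 hj), add_zero]
    · rw [hω.indicator_eq n j hj, Pi.add_apply,
        show f j ω = 0 from Set.indicator_of_notMem (s := D j) hj _, zero_add]
      split_ifs with hall
      · rw [Set.indicator_of_mem ((hUmem ω).2 ⟨hj, hall⟩)]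
        simp only [F, Pi.sub_apply, Finset.sum_apply]
        rw [Finset.sum_congr rfl fun i hi => hf i (hall i (Finset.mem_range.1 hi))]
      · rw [Set.indicator_of_notMem fun h => hall ((hUmem ω).1 h).2]
  refine (condExp_congr_ae hdecomp).trans ?_
  filter_upwards [condExp_add (hfint j) (hFint.indicator (hle _ hU)) (historySpace X n), hfg j,
    condExp_indicator hFint hU, hF] with ω h1 h2 h3 h4
  rw [h1, Pi.add_apply, h2, h3, quotaStep]
  by_cases hj : ρ j ≤ (X ω).counts n j
  · rw [if_pos hj, Set.indicator_of_notMem (fun h => ((hUmem ω).1 h).1 hj), add_zero]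
    exact Set.indicator_of_mem (s := D j) hj _
  · rw [if_neg hj, show g j ω = 0 from Set.indicator_of_notMem (s := D j) hj _, zero_add]
    split_ifs with hall
    · rw [Set.indicator_of_mem ((hUmem ω).2 ⟨hj, hall⟩), h4]
      simp only [Pi.sub_apply, Finset.sum_apply]
      congr 1
      exact Finset.sum_congr rfl fun i hi =>
        Set.indicator_of_mem (s := D i) (hall i (Finset.mem_range.1 hi)) _
    · rw [Set.indicator_of_notMem fun h => hall ((hUmem ω).1 h).2]

end Frequencies

/-! ### Counting constrained arrangements -/

/-- Block sizes of a constrained arrangement: a block that is followed by a nonempty one has its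
quota. -/
def IsQuotaCounts (ρ c : ℕ → ℕ) : Prop := ∀ j k, j < k → 0 < c k → ρ j ≤ c j

/-- The number of constrained arrangements with block sizes `c`, supported on the first `J` blocks:
the positions of block `0` beyond its quota are arbitrary, and the remaining elements form a
constrained arrangement for the shifted quotas. -/
def numArrangements : ℕ → (ℕ → ℕ) → (ℕ → ℕ) → ℕ
  | 0, _, _ => 1
  | J + 1, ρ, c => ((∑ i ∈ Finset.range (J + 1), c i) - ρ 0).choose (c 0 - ρ 0) *
      numArrangements J (fun i => ρ (i + 1)) fun i => c (i + 1)

/-- The block sizes before an element has been added to block `j`. -/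
def removeOne (c : ℕ → ℕ) (j : ℕ) : ℕ → ℕ := Function.update c j (c j - 1)

theorem removeOne_self (c : ℕ → ℕ) (j : ℕ) : removeOne c j j = c j - 1 :=
  Function.update_self ..

theorem removeOne_of_ne (c : ℕ → ℕ) {i j : ℕ} (h : i ≠ j) : removeOne c j i = c i :=
  Function.update_of_ne h ..

theorem removeOne_succ_shift (c : ℕ → ℕ) (j : ℕ) :
    (fun i => removeOne c (j + 1) (i + 1)) = removeOne (fun i => c (i + 1)) j := by
  ext i
  rcases eq_or_ne i j with rfl | h
  · simp [removeOne_self]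
  · rw [removeOne_of_ne _ h, removeOne_of_ne _ (by omega)]

theorem sum_removeOne_add_one {c : ℕ → ℕ} {j J : ℕ} (hj : j < J) (hc : 0 < c j) :
    ∑ i ∈ Finset.range J, removeOne c j i + 1 = ∑ i ∈ Finset.range J, c i := by
  have hmem := Finset.mem_range.2 hj
  rw [← Finset.add_sum_erase _ _ hmem, ← Finset.add_sum_erase _ _ hmem, removeOne_self,
    Finset.sum_congr rfl fun i hi => removeOne_of_ne c (Finset.ne_of_mem_erase hi)]
  omega

theorem isQuotaCounts_iff_shift {ρ c : ℕ → ℕ} :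
    IsQuotaCounts ρ c ↔ (∀ k, 0 < c (k + 1) → ρ 0 ≤ c 0) ∧
      IsQuotaCounts (fun i => ρ (i + 1)) fun i => c (i + 1) := by
  refine ⟨fun h => ⟨fun k hk => h 0 (k + 1) k.succ_pos hk,
    fun j k hjk hk => h (j + 1) (k + 1) (by omega) hk⟩, fun ⟨h0, h⟩ j k hjk hk => ?_⟩
  obtain ⟨k, rfl⟩ : ∃ k', k = k' + 1 := ⟨k - 1, by omega⟩
  cases j with
  | zero => exact h0 k hk
  | succ j => exact h j k (by omega) hk

/-- The recursion for constrained arrangements according to the block of the last element: an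
iterated Pascal rule. -/
theorem sum_numArrangements_removeOne (J : ℕ) : ∀ (ρ c : ℕ → ℕ), IsQuotaCounts ρ c →
    (∀ k, J ≤ k → c k = 0) → 0 < ∑ i ∈ Finset.range J, c i →
    ∑ j ∈ Finset.range J, (open Classical in
      if 0 < c j ∧ IsQuotaCounts ρ (removeOne c j) then numArrangements J ρ (removeOne c j)
      else 0) = numArrangements J ρ c := by
  classical
  induction J with
  | zero => intro ρ c _ _ h; simp at h
  | succ J ih =>
    intro ρ c hc hsupp hpos
    obtain ⟨h0, hshift⟩ := isQuotaCounts_iff_shift.1 hc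
    set ρ' : ℕ → ℕ := fun i => ρ (i + 1) with hρ'
    set c' : ℕ → ℕ := fun i => c (i + 1) with hc'
    have hsupp' : ∀ k, J ≤ k → c' k = 0 := fun k hk => hsupp (k + 1) (by omega)
    have htotal : ∑ i ∈ Finset.range (J + 1), c i = ∑ i ∈ Finset.range J, c' i + c 0 :=
      Finset.sum_range_succ' c J
    set b := ∑ i ∈ Finset.range J, c' i with hb
    have hremove0 : (fun i => removeOne c 0 (i + 1)) = c' := by
      ext i; exact removeOne_of_ne c (by omega)
    have hq0 : IsQuotaCounts ρ (removeOne c 0) ↔ ∀ k, 0 < c' k → ρ 0 ≤ c 0 - 1 := by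
      rw [isQuotaCounts_iff_shift, hremove0, removeOne_self]
      exact ⟨fun h k hk => h.1 k (by rwa [removeOne_of_ne c (by omega)]),
        fun h => ⟨fun k hk => h k (by rwa [removeOne_of_ne c (by omega)] at hk), hshift⟩⟩
    have hnum0 : 0 < c 0 → numArrangements (J + 1) ρ (removeOne c 0) =
        (b + c 0 - 1 - ρ 0).choose (c 0 - 1 - ρ 0) * numArrangements J ρ' c' := fun hpos0 => by
      have := sum_removeOne_add_one (J := J + 1) J.succ_pos hpos0
      rw [numArrangements, hremove0, removeOne_self,
        show ∑ i ∈ Finset.range (J + 1), removeOne c 0 i = b + c 0 - 1 by omega]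
    have hnum : numArrangements (J + 1) ρ c =
        (b + c 0 - ρ 0).choose (c 0 - ρ 0) * numArrangements J ρ' c' := by
      rw [numArrangements, htotal]
    rw [Finset.sum_range_succ', hnum]
    rcases Nat.eq_zero_or_pos b with hb0 | hbpos
    · -- only block `0` is left
      have hc0 : ∀ k, c' k = 0 := fun k => by
        rcases lt_or_ge k J with hk | hk
        · exact Finset.sum_eq_zero_iff.1 hb0 k (Finset.mem_range.2 hk)
        · exact hsupp' k hk
      have hpos0 : 0 < c 0 := by omega
      rw [Finset.sum_eq_zero fun j _ => if_neg fun h => h.1.ne' (hc0 j),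
        if_pos ⟨hpos0, hq0.2 fun k hk => absurd (hc0 k) hk.ne'⟩, hnum0 hpos0, hb0]
      simp
    · obtain ⟨k, hk, hkpos⟩ : ∃ k ∈ Finset.range J, 0 < c' k := by
        by_contra! h
        exact hbpos.ne' (Finset.sum_eq_zero fun i hi => Nat.le_zero.1 (h i hi))
      have hle : ρ 0 ≤ c 0 := h0 k hkpos
      have hterm : ∀ j ∈ Finset.range J,
          (if 0 < c (j + 1) ∧ IsQuotaCounts ρ (removeOne c (j + 1)) then
            numArrangements (J + 1) ρ (removeOne c (j + 1)) else 0) =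
          (b + c 0 - 1 - ρ 0).choose (c 0 - ρ 0) *
            if 0 < c' j ∧ IsQuotaCounts ρ' (removeOne c' j) then
              numArrangements J ρ' (removeOne c' j) else 0 := by
        intro j hj
        have hiff : IsQuotaCounts ρ (removeOne c (j + 1)) ↔
            IsQuotaCounts ρ' (removeOne c' j) := by
          rw [isQuotaCounts_iff_shift, removeOne_succ_shift, removeOne_of_ne c (by omega)]
          exact and_iff_right fun _ _ => hle
        rw [mul_ite, mul_zero]
        refine if_ctx_congr (and_congr Iff.rfl hiff) (fun h => ?_) fun _ => rfl
        have := sum_removeOne_add_one (c := c) (j := j + 1) (J := J + 1)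
          (Nat.succ_lt_succ (Finset.mem_range.1 hj)) h.1
        rw [numArrangements, removeOne_succ_shift, removeOne_of_ne c (by omega),
          show ∑ i ∈ Finset.range (J + 1), removeOne c (j + 1) i = b + c 0 - 1 by omega]
      rw [Finset.sum_congr rfl hterm, ← Finset.mul_sum, ih ρ' c' hshift hsupp' hbpos]
      rcases hle.eq_or_lt with heq | hlt
      · rw [if_neg, ← heq]
        · simp
        · rintro ⟨hpos0, h⟩
          have := hq0.1 h k hkpos
          omega
      · have hpos0 : 0 < c 0 := by omega
        rw [if_pos ⟨hpos0, hq0.2 fun _ _ => by omega⟩, hnum0 hpos0, ← add_mul]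
        congr 1
        obtain ⟨a, ha⟩ : ∃ a, c 0 = ρ 0 + a + 1 := ⟨c 0 - ρ 0 - 1, by omega⟩
        rw [show b + c 0 - ρ 0 = (b + a) + 1 by omega, show c 0 - ρ 0 = a + 1 by omega,
          show b + c 0 - 1 - ρ 0 = b + a by omega, show c 0 - 1 - ρ 0 = a by omega,
          Nat.choose_succ_succ, add_comm]

theorem sum_range_getD (l : List ℕ) : ∑ i ∈ Finset.range l.length, l.getD i 0 = l.sum := by
  induction l with
  | nil => simp
  | cons a l ih =>
    rw [List.length_cons, Finset.sum_range_succ', List.sum_cons, ← ih, add_comm]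
    simp

theorem numArrangements_eq_prod (l : List ℕ) : ∀ ρ : ℕ → ℕ,
    numArrangements l.length ρ (fun k => l.getD k 0) =
      ∏ j ∈ Finset.range l.length, ((l.drop j).sum - ρ j).choose (l.getD j 0 - ρ j) := by
  induction l with
  | nil => intro ρ; simp [numArrangements]
  | cons a l ih =>
    intro ρ
    have hsum := sum_range_getD (a :: l)
    have := ih fun i => ρ (i + 1)
    rw [List.length_cons] at hsum ⊢
    rw [numArrangements, hsum, Finset.prod_range_succ', mul_comm]
    congr 1

theorem numArrangements_eq_numConstrained (ρ : ℕ → ℕ) (l : List ℕ) :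
    numArrangements l.length ρ (fun k => l.getD k 0) = numConstrained ρ l := by
  rw [numArrangements_eq_prod, numConstrained]
  rcases Nat.eq_zero_or_pos l.length with h | h
  · simp [h]
  · obtain ⟨m, hm⟩ : ∃ m, l.length = m + 1 := ⟨l.length - 1, by omega⟩
    have hlast : (l.drop m).sum = l.getD m 0 := by
      rw [List.drop_eq_getElem_cons (by omega), List.drop_eq_nil_of_le (by omega),
        List.getD_eq_getElem _ _ (by omega)]
      simp
    rw [hm, Finset.prod_range_succ, hlast, Nat.choose_self, mul_one, Nat.add_sub_cancel]

/-! ### The distribution of the shapes -/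

/-- The conditional probability, given the frequencies `p`, of each constrained arrangement with
block sizes `c`, supported on the first `J` blocks. -/
noncomputable def quotaWeight (ρ : ℕ → ℕ) (p : ℕ → ℝ) (c : ℕ → ℕ) (J : ℕ) : ℝ :=
  ∏ j ∈ Finset.range J, (1 - ∑ i ∈ Finset.range j, p i) ^ min (ρ j) (c j) * p j ^ (c j - ρ j)

theorem quotaWeight_removeOne_mul_quotaStep {ρ : ℕ → ℕ} (p : ℕ → ℝ) {c : ℕ → ℕ} {j J : ℕ}
    (hc : IsQuotaCounts ρ c) (hj : j < J) (hpos : 0 < c j) :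
    quotaWeight ρ p (removeOne c j) J * quotaStep ρ p (removeOne c j) j = quotaWeight ρ p c J := by
  have hmem := Finset.mem_range.2 hj
  have hrest : ∀ i ∈ (Finset.range J).erase j, removeOne c j i = c i := fun i hi =>
    removeOne_of_ne c (Finset.ne_of_mem_erase hi)
  rw [quotaWeight, quotaWeight, ← Finset.mul_prod_erase _ _ hmem, ← Finset.mul_prod_erase _ _ hmem,
    Finset.prod_congr rfl fun i hi => by rw [hrest i hi], mul_right_comm]
  congr 1
  have hall : ∀ i < j, ρ i ≤ removeOne c j i := fun i hi => by
    rw [removeOne_of_ne c hi.ne]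
    exact hc i j hi hpos
  rw [quotaStep, if_pos hall, removeOne_self]
  split_ifs with h
  · rw [mul_assoc, ← pow_succ, min_eq_left h, min_eq_left (by omega : ρ j ≤ c j),
      show c j - 1 - ρ j + 1 = c j - ρ j by omega]
  · rw [mul_right_comm, ← pow_succ, min_eq_right (by omega : c j - 1 ≤ ρ j),
      min_eq_right (by omega : c j ≤ ρ j), show c j - 1 - ρ j = c j - ρ j by omega,
      show c j - 1 + 1 = c j by omega]

theorem mixtureTerm_eq_quotaWeight {ρ : ℕ → ℕ} (p : ℕ → ℝ) {l : List ℕ} (hl : l ≠ [])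
    (hc : IsConstrainedComposition ρ l) :
    mixtureTerm ρ p l = quotaWeight ρ p (fun k => l.getD k 0) l.length := by
  obtain ⟨m, hm⟩ : ∃ m, l.length = m + 1 :=
    ⟨l.length - 1, by have := List.length_pos_iff.2 hl; omega⟩
  rw [mixtureTerm, quotaWeight, hm, Finset.prod_range_succ, Nat.add_sub_cancel, mul_assoc]
  congr 1
  refine Finset.prod_congr rfl fun j hj => ?_
  rw [min_eq_left (hc j (by have := Finset.mem_range.1 hj; omega))]

theorem IsConstrainedComposition.isQuotaCounts {ρ : ℕ → ℕ} {l : List ℕ}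
    (hc : IsConstrainedComposition ρ l) : IsQuotaCounts ρ fun k => l.getD k 0 := by
  intro j k hjk hk
  refine hc j ?_
  by_contra h
  change 0 < l.getD k 0 at hk
  rw [List.getD_eq_default _ _ (by omega)] at hk
  exact hk.false

section Mixture

open NatPartition

variable {Ω : Type*} [MeasurableSpace Ω] {μ : Measure Ω} [IsProbabilityMeasure μ]
  {ρ : ℕ → ℕ} {X : Ω → NatPartition}

/-- The `σ`-algebra generated by the frequencies. -/
noncomputable abbrev freqSpace {Ω : Type*} (X : Ω → NatPartition) : MeasurableSpace Ω :=
  MeasurableSpace.comap (fun ω => (X ω).freq) inferInstance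

theorem freqSpace_le_historySpace {Ω : Type*} (X : Ω → NatPartition) (n : ℕ) :
    freqSpace X ≤ historySpace X n :=
  (measurable_freq_historySpace X n).comap_le

theorem measurable_quotaStep (ρ c : ℕ → ℕ) (j : ℕ) : Measurable fun p => quotaStep ρ p c j := by
  unfold quotaStep
  split_ifs
  · exact measurable_pi_apply j
  · exact measurable_const.sub (Finset.measurable_fun_sum _ fun i _ => measurable_pi_apply i)
  · exact measurable_const

theorem abs_quotaStep_freq_le (ρ c : ℕ → ℕ) (π : NatPartition) (j : ℕ) :
    |quotaStep ρ π.freq c j| ≤ 1 := by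
  have h1 := π.sum_freq_le_one (Finset.range j)
  have h2 : 0 ≤ ∑ i ∈ Finset.range j, π.freq i := Finset.sum_nonneg fun i _ => π.freq_nonneg i
  have h3 := π.freq_nonneg j
  have h4 := π.freq_le_one j
  unfold quotaStep
  rw [abs_le]
  split_ifs <;> constructor <;> linarith

theorem NatPartition.counts_succ_eq_iff {π : NatPartition} {n j : ℕ} {c : ℕ → ℕ}
    (hj : n ∈ π.block j) : π.counts (n + 1) = c ↔ 0 < c j ∧ π.counts n = removeOne c j := by
  have hself := counts_succ_of_mem hj
  have hne : ∀ i, i ≠ j → π.counts (n + 1) i = π.counts n i := fun i hi =>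
    counts_succ_of_notMem fun hni => hi (eq_of_mem_block hni hj)
  constructor
  · rintro rfl
    refine ⟨by omega, ?_⟩
    ext i
    rcases eq_or_ne i j with rfl | hi
    · rw [removeOne_self, hself, Nat.add_sub_cancel]
    · rw [removeOne_of_ne _ hi, hne i hi]
  · rintro ⟨hpos, hc⟩
    ext i
    rcases eq_or_ne i j with rfl | hi
    · rw [hself, hc, removeOne_self]
      omega
    · rw [hne i hi, hc, removeOne_of_ne _ hi]

theorem measurableSet_counts_eq (hX : Measurable X) (n : ℕ) (c : ℕ → ℕ) :
    MeasurableSet {ω | (X ω).counts n = c} :=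
  ((measurable_counts n).comp hX) (measurableSet_singleton c)

/-- The extension step: conditionally given the frequencies, the block sizes are `c` at time `n`
and the next element joins block `j`. -/
theorem IsConstrainedExchangeable.condExp_counts_inter (hρ : ∀ k, 1 ≤ ρ k)
    (hX : Measurable X) (hexch : IsConstrainedExchangeable μ ρ X) (n j : ℕ) (c : ℕ → ℕ) :
    μ[({ω | (X ω).counts n = c} ∩ {ω | n ∈ (X ω).block j}).indicator (fun _ => (1 : ℝ)) |
        freqSpace X] =ᵐ[μ]
      fun ω => quotaStep ρ (X ω).freq c j *
        (μ[{ω | (X ω).counts n = c}.indicator (fun _ => (1 : ℝ)) | freqSpace X]) ω := by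
  have hle := historySpace_le hX n
  have hC : MeasurableSet[historySpace X n] {ω | (X ω).counts n = c} :=
    measurable_counts_historySpace X n (measurableSet_singleton c)
  have hι : Integrable ({ω | n ∈ (X ω).block j}.indicator fun _ => (1 : ℝ)) μ :=
    (integrable_const _).indicator (measurableSet_mem_block_comp hX n j)
  have hCi : Integrable ({ω | (X ω).counts n = c}.indicator fun _ => (1 : ℝ)) μ :=
    (integrable_const _).indicator (hle _ hC)
  let q : Ω → ℝ := fun ω => quotaStep ρ (X ω).freq c j
  have hq : StronglyMeasurable[freqSpace X] q :=
    ((measurable_quotaStep ρ c j).comp (comap_measurable _)).stronglyMeasurable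
  have hhist : μ[({ω | (X ω).counts n = c} ∩ {ω | n ∈ (X ω).block j}).indicator
      (fun _ => (1 : ℝ)) | historySpace X n] =ᵐ[μ]
      q * {ω | (X ω).counts n = c}.indicator (fun _ => (1 : ℝ)) := by
    rw [← Set.indicator_indicator]
    filter_upwards [condExp_indicator hι hC, hexch.condExp_mem_block hρ hX n j] with ω h1 h2
    rw [h1, Pi.mul_apply]
    by_cases h : ω ∈ {ω | (X ω).counts n = c}
    · rw [Set.indicator_of_mem h, Set.indicator_of_mem h, h2, mul_one]
      exact congrArg (fun c' => quotaStep ρ (X ω).freq c' j) h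
    · rw [Set.indicator_of_notMem h, Set.indicator_of_notMem h, mul_zero]
  have hqC : Integrable (q * {ω | (X ω).counts n = c}.indicator fun _ => (1 : ℝ)) μ :=
    hCi.bdd_mul (c := 1)
      (hq.mono ((freqSpace_le_historySpace X n).trans hle)).aestronglyMeasurable
      (ae_of_all _ fun ω => abs_quotaStep_freq_le ρ c (X ω) j)
  exact (condExp_condExp_of_le (freqSpace_le_historySpace X n) hle).symm.trans
    ((condExp_congr_ae hhist).trans (condExp_mul_of_stronglyMeasurable_left hq hqC hCi))

theorem IsConstrainedExchangeable.condExp_counts_eq (hρ : ∀ k, 1 ≤ ρ k)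
    (hX : Measurable X) (hexch : IsConstrainedExchangeable μ ρ X) (J n : ℕ) :
    ∀ c : ℕ → ℕ, IsQuotaCounts ρ c → (∀ k, J ≤ k → c k = 0) →
      ∑ i ∈ Finset.range J, c i = n →
      μ[{ω | (X ω).counts n = c}.indicator (fun _ => (1 : ℝ)) | freqSpace X] =ᵐ[μ]
        fun ω => numArrangements J ρ c * quotaWeight ρ (X ω).freq c J := by
  classical
  induction n with
  | zero =>
    intro c _ hsupp hsum
    have hc : c = 0 := by
      ext k
      rcases lt_or_ge k J with hk | hk
      · exact Finset.sum_eq_zero_iff.1 hsum k (Finset.mem_range.2 hk)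
      · exact hsupp k hk
    have hset : {ω | (X ω).counts 0 = c} = Set.univ := by
      ext ω
      simp only [Set.mem_ofPred_eq, Set.mem_univ, iff_true, hc]
      ext k
      exact counts_zero _ _
    have hnum : ∀ (J : ℕ) (ρ : ℕ → ℕ), numArrangements J ρ 0 = 1 := fun J => by
      induction J with
      | zero => exact fun _ => rfl
      | succ J ih =>
        intro ρ
        rw [numArrangements, show (fun i => (0 : ℕ → ℕ) (i + 1)) = 0 from rfl, ih]
        simp
    rw [hset, Set.indicator_univ,
      condExp_const ((freqSpace_le_historySpace X 0).trans (historySpace_le hX 0)), hc]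
    refine ae_of_all _ fun ω => ?_
    simp [hnum, quotaWeight]
  | succ n ih =>
    intro c hc hsupp hsum
    let B : ℕ → Set Ω := fun j =>
      if 0 < c j then {ω | (X ω).counts n = removeOne c j} ∩ {ω | n ∈ (X ω).block j} else ∅
    have hBm : ∀ j, MeasurableSet (B j) := fun j => by
      simp only [B]
      split_ifs
      · exact (measurableSet_counts_eq hX n _).inter (measurableSet_mem_block_comp hX n j)
      · exact MeasurableSet.empty
    have hBmem : ∀ j ω, ω ∈ B j ↔ n ∈ (X ω).block j ∧ (X ω).counts (n + 1) = c := fun j ω => by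
      simp only [B]
      split_ifs with hpos
      · refine ⟨fun h => ⟨h.2, (counts_succ_eq_iff h.2).2 ⟨hpos, h.1⟩⟩,
          fun h => ⟨((counts_succ_eq_iff h.1).1 h.2).2, h.1⟩⟩
      · refine ⟨fun h => h.elim, fun h => absurd ((counts_succ_eq_iff h.1).1 h.2).1 hpos⟩
    -- split according to the block of the last element
    have hsplit : {ω | (X ω).counts (n + 1) = c}.indicator (fun _ => (1 : ℝ)) =
        ∑ j ∈ Finset.range J, (B j).indicator fun _ => (1 : ℝ) := by
      ext ω
      obtain ⟨k, hk⟩ := (X ω).exists_mem_block n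
      have hind : ∀ j, (B j).indicator (fun _ => (1 : ℝ)) ω =
          if j = k then {ω | (X ω).counts (n + 1) = c}.indicator (fun _ => (1 : ℝ)) ω else 0 := by
        intro j
        simp only [Set.indicator_apply, hBmem]
        rcases eq_or_ne j k with rfl | hjk
        · simp [hk]
        · simp [hjk, show n ∉ (X ω).block j from fun h => hjk (eq_of_mem_block h hk)]
      rw [Finset.sum_apply, Finset.sum_congr rfl fun j _ => hind j, Finset.sum_ite_eq']
      split_ifs with hkJ
      · rfl
      · refine Set.indicator_of_notMem (fun h => ?_) _
        have := ((counts_succ_eq_iff hk).1 h).1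
        rw [hsupp k (by simpa using hkJ)] at this
        exact this.false
    have hterm : ∀ j ∈ Finset.range J,
        μ[(B j).indicator (fun _ => (1 : ℝ)) | freqSpace X] =ᵐ[μ] fun ω =>
          ((if 0 < c j ∧ IsQuotaCounts ρ (removeOne c j) then
            numArrangements J ρ (removeOne c j) else 0 : ℕ) : ℝ) *
            quotaWeight ρ (X ω).freq c J := by
      intro j hj
      have hjJ := Finset.mem_range.1 hj
      by_cases hpos : 0 < c j
      swap
      · rw [if_neg fun h => hpos h.1]
        simp only [B, if_neg hpos, Set.indicator_empty, Nat.cast_zero, zero_mul]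
        rw [condExp_const ((freqSpace_le_historySpace X 0).trans (historySpace_le hX 0))]
      by_cases hq : IsQuotaCounts ρ (removeOne c j)
      · rw [if_pos ⟨hpos, hq⟩]
        simp only [B, if_pos hpos]
        have hsum' := sum_removeOne_add_one hjJ hpos
        filter_upwards [hexch.condExp_counts_inter hρ hX n j (removeOne c j),
          ih (removeOne c j) hq
            (fun k hk => by rw [removeOne_of_ne c (by omega), hsupp k hk]) (by omega)]
          with ω h1 h2
        rw [h1, h2, ← quotaWeight_removeOne_mul_quotaStep (X ω).freq hc hjJ hpos]
        ring
      · -- constrained partitions do not have these block sizes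
        rw [if_neg fun h => hq h.2]
        have hnull : (B j).indicator (fun _ => (1 : ℝ)) =ᵐ[μ] fun _ => 0 := by
          filter_upwards [hexch.1] with ω hω
          refine Set.indicator_of_notMem (fun h => hq ?_) _
          simp only [B, if_pos hpos] at h
          rw [← show (X ω).counts n = removeOne c j from h.1]
          exact fun a b hab hb => hω.le_counts hab hb
        refine (condExp_congr_ae hnull).trans ?_
        rw [condExp_const ((freqSpace_le_historySpace X 0).trans (historySpace_le hX 0))]
        simp only [Nat.cast_zero, zero_mul]
        rfl
    rw [hsplit]
    refine (condExp_finsetSum (fun j _ => (integrable_const _).indicator (hBm j)) _).trans ?_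
    have hterm' := (Finset.eventually_all (Finset.range J)).2 hterm
    filter_upwards [hterm'] with ω hω
    rw [Finset.sum_apply, Finset.sum_congr rfl hω, ← Finset.sum_mul, ← Nat.cast_sum,
      sum_numArrangements_removeOne J ρ c hc hsupp (by omega)]

theorem IsConstrainedExchangeable.measureReal_shape_eq (hρ : ∀ k, 1 ≤ ρ k)
    (hX : Measurable X) (hexch : IsConstrainedExchangeable μ ρ X) {n : ℕ} (hn : 1 ≤ n)
    (c : Composition n) (hc : IsConstrainedComposition ρ c.blocks) :
    μ.real {ω | (X ω).shape n = c.blocks} =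
      (numConstrained ρ c.blocks : ℝ) * ∫ ω, mixtureTerm ρ (X ω).freq c.blocks ∂μ := by
  have hle := (freqSpace_le_historySpace X 0).trans (historySpace_le hX 0)
  have hne : c.blocks ≠ [] := fun h => by
    have := c.blocks_sum
    rw [h, List.sum_nil] at this
    omega
  have key := hexch.condExp_counts_eq hρ hX c.blocks.length n _ hc.isQuotaCounts
    (fun k hk => List.getD_eq_default _ _ hk) ((sum_range_getD _).trans c.blocks_sum)
  have hset : {ω | (X ω).shape n = c.blocks} =
      {ω | (X ω).counts n = fun k => c.blocks.getD k 0} := by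
    ext ω
    exact shape_eq_iff fun a ha => c.blocks_pos ha
  rw [hset, ← integral_indicator_one (measurableSet_counts_eq hX n _)]
  refine (integral_condExp hle).symm.trans ((integral_congr_ae key).trans ?_)
  rw [integral_const_mul, numArrangements_eq_numConstrained]
  simp_rw [mixtureTerm_eq_quotaWeight _ hne hc]

end Mixture

theorem proposition3 {Ω : Type*} [MeasurableSpace Ω] (μ : MeasureTheory.Measure Ω)
    [MeasureTheory.IsProbabilityMeasure μ] (ρ : ℕ → ℕ) (hρ : ∀ k, 1 ≤ ρ k)
    (X : Ω → NatPartition) (hX : Measurable X) (hexch : IsConstrainedExchangeable μ ρ X) :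
    ∃ P : Ω → ℕ → ℝ, Measurable P ∧
      (∀ ω j, 0 ≤ P ω j) ∧
      (∀ ω, Summable (P ω) ∧ ∑' j, P ω j ≤ 1) ∧
      (∀ᵐ ω ∂μ, Filter.Tendsto
        (fun (n : ℕ) (j : ℕ) => ((((X ω).shape n).getD j 0 : ℕ) : ℝ) / (n : ℝ))
        Filter.atTop (nhds (P ω))) ∧
      IsDirectedBy μ ρ P X ∧
      (∀ (n : ℕ), 1 ≤ n → ∀ c : Composition n, IsConstrainedComposition ρ c.blocks →
        μ.real {ω | (X ω).shape n = c.blocks} =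
          (numConstrained ρ c.blocks : ℝ) * ∫ ω, mixtureTerm ρ (P ω) c.blocks ∂μ) := by
  refine ⟨fun ω => (X ω).freq, NatPartition.measurable_freq.comp hX,
    fun ω j => (X ω).freq_nonneg j, fun ω => ⟨(X ω).summable_freq, (X ω).tsum_freq_le_one⟩,
    ?_, fun n hn j => ?_, fun n hn c hc => hexch.measureReal_shape_eq hρ hX hn c hc⟩
  · filter_upwards [hexch.ae_tendsto_freq hρ hX] with ω hω
    refine tendsto_pi_nhds.2 fun j => ?_
    simpa only [NatPartition.shape_getD] using hω j
  · refine (hexch.condExp_mem_block hρ hX n j).trans ?_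
    filter_upwards [hexch.1] with ω hω
    exact (stepProb_shape hρ hω _ hn j).symm
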